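/- Let $r\ge 1$, $0\le a<r$ and $N\ge 0$ be integers and let $\omega_r=e^{2\pi i/r}$. Let $B_{r,j}$ be the ray from $0$ to $\omega_r^j\cdot\infty$ and let $C_{r,a}=\sum_{j=0}^{r-1}\omega_r^{-ja}B_{r,j}$ (a formal linear combination of contours). For a polynomial $\mathcal O(x_1,\dots,x_N)$ put $$Z_N^{(r,a)}[\mathcal O]=\frac1{N!}\int_{C_{r,a}^N}\mathcal O(x_1,\dots,x_N)\prod_{i=1}^N\frac{dx_i}{2\pi}\,e^{-x_i^r}\prod_{i>j}(x_i-x_j)^2,\qquad Z_N^{(r,a)}=Z_N^{(r,a)}[1],$$ and, when $Z_N^{(r,a)}\ne0$, let $\langle\mathcal O\rangle=Z_N^{(r,a)}[\mathcal O]/Z_N^{(r,a)}$. For a partition $\lambda=(\lambda_1\ge\dots\ge\lambda_N\ge0)$, let $s_\lambda(x)=\det(x_i^{N+\lambda_j-j})/\det(x_i^{N-j})$ be the Schur polynomial in $N$ variables. Let $\lambda^\top$ be the conjugate partition and regard $\lambda$ as a Young diagram with $|\lambda|$ boxes $x=(i,j)$, with contents $c_\lambda(x)=j-i$ and hook lengths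 $h_\lambda(x)=\lambda_i+\lambda^\top_j-i-j+1$. The $r$-core of $\lambda$ is the diagram obtained by successively stripping rim hooks of length $r$ from $\lambda$ until none remains. **Theorem.** If $Z_N^{(r,a)}\neq0$, then for every partition $\lambda$ with at most $N$ rows $$\langle s_\lambda(X)\rangle=\frac{\delta_r(\lambda)}{r^{|\lambda|/r}}\prod_{x\in\lambda}\frac{[\![N+c_\lambda(x)]\!]_{r,0}\,[\![N+c_\lambda(x)]\!]_{r,a}}{[\![h_\lambda(x)]\!]_{r,0}},$$ where $[\![n]\!]_{r,a}=n$ if $n\equiv a\pmod r$ and $[\![n]\!]_{r,a}=1$ otherwise, and where the $r$-signature $\delta_r(\lambda)\in\{0,\pm1\}$ is $$\delta_r(\lambda)=\begin{cases}(-1)^{|\lambda|/r}\prod_{x\in\lambda}(-1)^{\lfloor c_\lambda(x)/r\rfloor+\lfloor h_\lambda(x)/r\rfloor}&\text{if the $r$-core of $\lambda$ is empty,}\\0&\text{otherwise.}\end{cases}$$ -/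

import Mathlib

open scoped BigOperators Nat

namespace MonomialModel

/-! ### Schur polynomials -/

/-- The alternant `det (x_i ^ (λ_j + N - j))` (rows and columns counted from `1`), as a polynomial
in `x_1, …, x_N`.  Row and column indices are counted from `0` in the code, so the exponent in
column `j` is `λ.rowLen j + (N - 1 - j)`; as `j < N`, the subtraction does not truncate.
For the empty diagram this is `det (x_i ^ (N - j))`. -/
noncomputable def alternant (N : ℕ) (lam : YoungDiagram) : MvPolynomial (Fin N) ℂ :=
  Matrix.det (Matrix.of fun i j : Fin N =>
    (MvPolynomial.X i : MvPolynomial (Fin N) ℂ) ^ (lam.rowLen j + (N - 1 - (j : ℕ))))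

theorem alternant_bot (N : ℕ) :
    alternant N ⊥ = ∏ i : Fin N, ∏ j ∈ Finset.Ioi i,
      ((MvPolynomial.X i : MvPolynomial (Fin N) ℂ) - MvPolynomial.X j) := by
  have hrow : ∀ k, (⊥ : YoungDiagram).rowLen k = 0 := fun k => by
    rw [YoungDiagram.rowLen_eq_card, Finset.card_eq_zero, Finset.eq_empty_iff_forall_notMem]
    intro x hx
    exact YoungDiagram.notMem_bot x (YoungDiagram.mem_row_iff.1 hx).1
  have h := Matrix.det_projVandermonde (fun _ : Fin N => (1 : MvPolynomial (Fin N) ℂ))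
    (fun i => MvPolynomial.X i)
  simp only [one_mul] at h
  rw [← h, alternant]
  congr 1
  ext1 i j
  have hj : N - 1 - (j : ℕ) = N - ((j : ℕ) + 1) := by omega
  simp [Matrix.projVandermonde_apply, hrow, Fin.val_rev, hj]

theorem X_sub_X_ne_zero {N : ℕ} {i j : Fin N} (h : i ≠ j) :
    (MvPolynomial.X i - MvPolynomial.X j : MvPolynomial (Fin N) ℂ) ≠ 0 :=
  fun h0 => h (MvPolynomial.X_injective (sub_eq_zero.1 h0))

theorem alternant_bot_ne_zero (N : ℕ) : alternant N ⊥ ≠ 0 := by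
  rw [alternant_bot]
  refine Finset.prod_ne_zero_iff.2 fun i _ => Finset.prod_ne_zero_iff.2 fun j hj => ?_
  exact X_sub_X_ne_zero (Finset.mem_Ioi.1 hj).ne

theorem irreducible_X_sub_X {N : ℕ} {i j : Fin N} (h : i ≠ j) :
    Irreducible (MvPolynomial.X i - MvPolynomial.X j : MvPolynomial (Fin N) ℂ) := by
  classical
  have hc : MvPolynomial.coeff (Finsupp.single i 1)
      (MvPolynomial.X i - MvPolynomial.X j : MvPolynomial (Fin N) ℂ) = 1 := by
    simp [MvPolynomial.coeff_X, Finsupp.single_left_inj, h.symm]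
  apply MvPolynomial.irreducible_of_totalDegree_eq_one
  · apply le_antisymm
    · refine (MvPolynomial.totalDegree_sub _ _).trans ?_
      simp
    · have := MvPolynomial.le_totalDegree (p := (MvPolynomial.X i - MvPolynomial.X j :
        MvPolynomial (Fin N) ℂ)) (s := Finsupp.single i 1)
        (by rw [MvPolynomial.mem_support_iff, hc]; exact one_ne_zero)
      simpa using this
  · intro x hx
    have := hx (Finsupp.single i 1)
    rw [hc] at this
    exact isUnit_of_dvd_one this

theorem X_sub_X_dvd_alternant {N : ℕ} (lam : YoungDiagram) {i j : Fin N} (h : i ≠ j) :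
    (MvPolynomial.X i - MvPolynomial.X j : MvPolynomial (Fin N) ℂ) ∣ alternant N lam := by
  rw [← Ideal.mem_span_singleton, ← Ideal.Quotient.eq_zero_iff_mem, alternant, RingHom.map_det]
  refine Matrix.det_zero_of_row_eq h ?_
  have hij : Ideal.Quotient.mk (Ideal.span {(MvPolynomial.X i - MvPolynomial.X j :
      MvPolynomial (Fin N) ℂ)}) (MvPolynomial.X i) = Ideal.Quotient.mk _ (MvPolynomial.X j) :=
    Ideal.Quotient.eq.2 (Ideal.mem_span_singleton_self _)
  ext k
  simp [hij]

/-- The quotient of the two alternants is a polynomial. -/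
theorem alternant_bot_dvd (N : ℕ) (lam : YoungDiagram) : alternant N ⊥ ∣ alternant N lam := by
  classical
  rw [alternant_bot, Finset.prod_sigma']
  refine Finset.prod_dvd_of_isRelPrime ?_ ?_
  · rintro ⟨i, j⟩ hij ⟨k, l⟩ hkl hne
    simp only [Finset.coe_sigma, Set.mem_sigma_iff, Finset.mem_coe, Finset.mem_univ,
      Finset.mem_Ioi, true_and] at hij hkl
    refine (irreducible_X_sub_X hij.ne).isRelPrime_iff_not_dvd.2 ?_
    rintro ⟨q, hq⟩
    have h2 := congrArg (MvPolynomial.eval fun m : Fin N =>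
      if m = i ∨ m = j then (0 : ℂ) else ((m : ℕ) : ℂ) + 1) hq
    simp only [map_sub, MvPolynomial.eval_X, map_mul, true_or, or_true, if_true, sub_self,
      zero_mul] at h2
    have hpos : ∀ m : ℕ, (m : ℂ) + 1 ≠ 0 := fun m => Nat.cast_add_one_ne_zero m
    apply hne
    rw [sub_eq_zero] at h2
    split_ifs at h2 with h3 h4 h4
    · have : i = k ∧ j = l := by omega
      obtain ⟨rfl, rfl⟩ := this
      rfl
    · exact absurd h2.symm (hpos _)
    · exact absurd h2 (hpos _)
    · have : (k : ℕ) = l := by exact_mod_cast add_right_cancel h2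
      omega
  · rintro ⟨i, j⟩ hij
    simp only [Finset.mem_sigma, Finset.mem_univ, Finset.mem_Ioi, true_and] at hij
    exact X_sub_X_dvd_alternant lam hij.ne

/-- The Schur polynomial `s_λ(x_1, …, x_N) = det (x_i ^ (N + λ_j - j)) / det (x_i ^ (N - j))`, for
a Young diagram `λ` with at most `N` rows. -/
noncomputable def schur (N : ℕ) (lam : YoungDiagram) : MvPolynomial (Fin N) ℂ :=
  (alternant_bot_dvd N lam).choose

/-- `schur N lam` is the unique polynomial which is the quotient of the two alternants. -/
theorem schur_unique (N : ℕ) (lam : YoungDiagram) (s : MvPolynomial (Fin N) ℂ) :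
    s = schur N lam ↔ alternant N lam = alternant N ⊥ * s := by
  have h : alternant N lam = alternant N ⊥ * schur N lam := (alternant_bot_dvd N lam).choose_spec
  constructor
  · rintro rfl
    exact h
  · intro hs
    exact mul_left_cancel₀ (alternant_bot_ne_zero N) (hs.symm.trans h)

/-! ### The pure-phase eigenvalue model -/

/-- `ω_r = exp (2 π i / r)`. -/
noncomputable def omega (r : ℕ) : ℂ := Complex.exp (2 * Real.pi * Complex.I / r)

/-- The integral `∫ f(x_1, …, x_N) dx_1 ⋯ dx_N` over the product contour `C_{r,a}^N`, where
`C_{r,a} = ∑_{j=0}^{r-1} ω_r^{-ja} B_{r,j}` and `B_{r,j}` is the ray from `0` to `ω_r^j ∞`,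
parametrised by `x = ω_r^j t`, `0 < t < ∞`, so that `dx = ω_r^j dt`. -/
noncomputable def contourIntegral (r a N : ℕ) (f : (Fin N → ℂ) → ℂ) : ℂ :=
  ∑ j : Fin N → Fin r, (∏ i, ((omega r ^ ((j i : ℕ) * a))⁻¹ * omega r ^ (j i : ℕ))) *
    ∫ t in Set.univ.pi fun _ : Fin N => Set.Ioi (0 : ℝ),
      f fun i => omega r ^ (j i : ℕ) * (t i : ℂ)

/-- The integrand `∏_i (e^{-x_i^r} / 2π) ∏_{i>j} (x_i - x_j)^2` of the partition function, with the
polynomial `O(x_1, …, x_N)` inserted. -/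
noncomputable def integrand (r N : ℕ) (O : MvPolynomial (Fin N) ℂ) (x : Fin N → ℂ) : ℂ :=
  MvPolynomial.eval x O * (∏ i, Complex.exp (-(x i) ^ r) / (2 * Real.pi)) *
    ∏ i, ∏ j ∈ Finset.Iio i, (x i - x j) ^ 2

/-- The integrals over the rays that make up the contour converge absolutely. -/
theorem integrableOn_integrand {r : ℕ} (hr : 0 < r) (N : ℕ) (O : MvPolynomial (Fin N) ℂ)
    (j : Fin N → Fin r) :
    MeasureTheory.IntegrableOn
      (fun t : Fin N → ℝ => integrand r N O fun i => omega r ^ (j i : ℕ) * (t i : ℂ))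
      (Set.univ.pi fun _ : Fin N => Set.Ioi (0 : ℝ)) := by
  have hom : omega r ^ r = 1 := by
    rw [omega, ← Complex.exp_nat_mul, mul_div_cancel₀ _ (by exact_mod_cast hr.ne')]
    exact Complex.exp_two_pi_mul_I
  have h1 : ∀ (n : ℕ) (k : Fin r), MeasureTheory.IntegrableOn
      (fun t : ℝ => (omega r ^ (k : ℕ) * (t : ℂ)) ^ n *
        (Complex.exp (-(omega r ^ (k : ℕ) * (t : ℂ)) ^ r) / (2 * Real.pi))) (Set.Ioi 0) := by
    intro n k
    have h := integrableOn_rpow_mul_exp_neg_rpow (p := (r : ℝ)) (s := (n : ℝ))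
      (by have : (0 : ℝ) ≤ n := Nat.cast_nonneg n
          linarith) (by exact_mod_cast hr)
    have h' := (h.ofReal (𝕜 := ℂ)).const_mul ((omega r ^ (k : ℕ)) ^ n / (2 * Real.pi))
    refine h'.congr (Filter.Eventually.of_forall fun t => ?_)
    have e : (omega r ^ (k : ℕ) * (t : ℂ)) ^ r = (t : ℂ) ^ r := by
      rw [mul_pow, ← pow_mul, mul_comm (k : ℕ), pow_mul, hom, one_pow, one_mul]
    simp only [e, Real.rpow_natCast, Complex.coe_algebraMap, Complex.ofReal_mul,
      Complex.ofReal_pow, Complex.ofReal_exp, Complex.ofReal_neg, mul_pow]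
    ring
  have h2 : ∀ Q : MvPolynomial (Fin N) ℂ, MeasureTheory.IntegrableOn
      (fun t : Fin N → ℝ => MvPolynomial.eval (fun i => omega r ^ (j i : ℕ) * (t i : ℂ)) Q *
        ∏ i, Complex.exp (-(omega r ^ (j i : ℕ) * (t i : ℂ)) ^ r) / (2 * Real.pi))
      (Set.univ.pi fun _ : Fin N => Set.Ioi (0 : ℝ)) := by
    intro Q
    induction Q using MvPolynomial.induction_on' with
    | monomial u c =>
      have hp := MeasureTheory.Integrable.fintype_prod
        (μ := fun _ : Fin N => MeasureTheory.volume.restrict (Set.Ioi (0 : ℝ)))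
        (fun i => h1 (u i) (j i))
      rw [← MeasureTheory.Measure.restrict_pi_pi] at hp
      refine (hp.const_mul c).congr (Filter.Eventually.of_forall fun t => ?_)
      simp only [MvPolynomial.eval_monomial, Finset.prod_mul_distrib]
      rw [Finsupp.prod_fintype _ _ (fun i => pow_zero _), mul_assoc]
    | add p q hp hq =>
      refine (hp.add hq).congr (Filter.Eventually.of_forall fun t => ?_)
      simp only [Pi.add_apply, map_add, add_mul]
  have h3 := h2 (O * ∏ i, ∏ k ∈ Finset.Iio i, (MvPolynomial.X i - MvPolynomial.X k) ^ 2)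
  refine h3.congr (Filter.Eventually.of_forall fun t => ?_)
  simp only [integrand, map_mul, map_prod, map_pow, map_sub, MvPolynomial.eval_X]
  ring

/-- The partition function with insertion, `Z_N^{(r,a)}[O]`, of the pure-phase monomial model. -/
noncomputable def ZInsert (r a N : ℕ) (O : MvPolynomial (Fin N) ℂ) : ℂ :=
  (1 / (N ! : ℂ)) * contourIntegral r a N (integrand r N O)

/-- The partition function `Z_N^{(r,a)}`. -/
noncomputable def Z (r a N : ℕ) : ℂ := ZInsert r a N 1

/-- The normalised expectation value `⟨O⟩ = Z[O] / Z`, meaningful when `Z ≠ 0`. -/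
noncomputable def average (r a N : ℕ) (O : MvPolynomial (Fin N) ℂ) : ℂ :=
  ZInsert r a N O / Z r a N

/-! ### Contents, hook lengths, cores and signatures

The box `(i, j)` of a `YoungDiagram` has row and column indices counted from `0`. -/

/-- The content, column index minus row index. -/
def content (x : ℕ × ℕ) : ℤ := (x.2 : ℤ) - (x.1 : ℤ)

/-- The hook length `λ_i + λᵀ_j - i - j + 1` with `i, j` counted from `1`, that is
`λ_i + λᵀ_j - i - j - 1` with `i, j` counted from `0`. -/
def hookLength (lam : YoungDiagram) (x : ℕ × ℕ) : ℤ :=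
  (lam.rowLen x.1 : ℤ) + (lam.colLen x.2 : ℤ) - (x.1 : ℤ) - (x.2 : ℤ) - 1

/-- The rim hook associated to the box `x` of `λ`: the boxes of `λ` weakly below and weakly to the
right of `x` which lie on the rim, i.e. whose lower right diagonal neighbour is not in `λ`. -/
def rimHook (lam : YoungDiagram) (x : ℕ × ℕ) : Finset (ℕ × ℕ) :=
  lam.cells.filter fun y => x.1 ≤ y.1 ∧ x.2 ≤ y.2 ∧ (y.1 + 1, y.2 + 1) ∉ lam

/-- `mu` results from `lam` by stripping one rim hook of length `r`. -/
def StripsTo (r : ℕ) (lam mu : YoungDiagram) : Prop :=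
  ∃ x ∈ lam, (rimHook lam x).card = r ∧ mu.cells = lam.cells \ rimHook lam x

/-- `chi` is the `r`-core of `lam`: it results from `lam` by successively stripping rim hooks of
length `r` until none remains. -/
def IsCoreOf (r : ℕ) (chi lam : YoungDiagram) : Prop :=
  Relation.ReflTransGen (StripsTo r) lam chi ∧ ∀ mu, ¬ StripsTo r chi mu

open scoped Classical in
/-- The `r`-signature `δ_r(λ)`.  The integer division `/ (r : ℤ)` rounds down, and `|λ| / r` is
exact when the `r`-core is empty. -/
noncomputable def signature (r : ℕ) (lam : YoungDiagram) : ℤ :=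
  if IsCoreOf r ⊥ lam then
    (-1) ^ (lam.card / r) *
      ∏ x ∈ lam.cells, (Int.negOnePow (content x / (r : ℤ) + hookLength lam x / (r : ℤ)) : ℤ)
  else 0

/-- The bracket `⟦n⟧_{r,a}`: equal to `n` if `n ≡ a mod r`, and to `1` otherwise. -/
def bracket (r a : ℕ) (n : ℤ) : ℤ := if n ≡ (a : ℤ) [ZMOD (r : ℤ)] then n else 1

end MonomialModel

namespace MonomialModel

/-! ### Moments and the determinant formula -/

/-- The number `λ_i + N - 1 - i`, the `i`-th exponent of the alternant. -/
def beta (N : ℕ) (lam : YoungDiagram) (i : Fin N) : ℕ := lam.rowLen i + (N - 1 - (i : ℕ))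

/-- The `n`-th moment of the weight `e^{-x^r} / 2π` along the contour `C_{r,a}`. -/
noncomputable def moment (r a n : ℕ) : ℂ :=
  if n + 1 ≡ a [MOD r] then ((Real.Gamma ((n + 1 : ℕ) / r) / (2 * Real.pi) : ℝ) : ℂ) else 0

theorem omega_isPrimitiveRoot {r : ℕ} (hr : 0 < r) : IsPrimitiveRoot (omega r) r :=
  Complex.isPrimitiveRoot_exp r hr.ne'

theorem ray_integrand_eq {r : ℕ} (hr : 0 < r) (n k : ℕ) (t : ℝ) :
    (omega r ^ k * (t : ℂ)) ^ n *
        (Complex.exp (-(omega r ^ k * (t : ℂ)) ^ r) / (2 * Real.pi)) =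
      (omega r ^ k) ^ n / (2 * Real.pi) *
        ((t ^ (n : ℝ) * Real.exp (-t ^ (r : ℝ)) : ℝ) : ℂ) := by
  have e : (omega r ^ k * (t : ℂ)) ^ r = (t : ℂ) ^ r := by
    rw [mul_pow, ← pow_mul, mul_comm k, pow_mul, (omega_isPrimitiveRoot hr).pow_eq_one, one_pow,
      one_mul]
  simp only [e, Real.rpow_natCast, Complex.ofReal_mul, Complex.ofReal_pow, Complex.ofReal_exp,
    Complex.ofReal_neg, mul_pow]
  ring

theorem integrableOn_ray {r : ℕ} (hr : 0 < r) (n k : ℕ) :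
    MeasureTheory.IntegrableOn (fun t : ℝ => (omega r ^ k * (t : ℂ)) ^ n *
        (Complex.exp (-(omega r ^ k * (t : ℂ)) ^ r) / (2 * Real.pi))) (Set.Ioi 0) := by
  have h := integrableOn_rpow_mul_exp_neg_rpow (p := (r : ℝ)) (s := (n : ℝ))
    (by have : (0 : ℝ) ≤ n := Nat.cast_nonneg n
        linarith) (by exact_mod_cast hr)
  refine ((h.ofReal (𝕜 := ℂ)).const_mul ((omega r ^ k) ^ n / (2 * Real.pi))).congr
    (Filter.Eventually.of_forall fun t => ?_)
  exact (ray_integrand_eq hr n k t).symm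

theorem integral_ray {r : ℕ} (hr : 0 < r) (n k : ℕ) :
    ∫ t in Set.Ioi (0 : ℝ), (omega r ^ k * (t : ℂ)) ^ n *
        (Complex.exp (-(omega r ^ k * (t : ℂ)) ^ r) / (2 * Real.pi)) =
      (omega r ^ k) ^ n / (2 * Real.pi) * ((1 / r * Real.Gamma ((n + 1 : ℕ) / r) : ℝ) : ℂ) := by
  simp only [ray_integrand_eq hr]
  rw [MeasureTheory.integral_const_mul]
  congr 1
  rw [integral_complex_ofReal, integral_rpow_mul_exp_neg_rpow (by exact_mod_cast hr)
    (by have : (0 : ℝ) ≤ n := Nat.cast_nonneg n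
        linarith)]
  push_cast
  rfl

theorem sum_omega_pow {r a n : ℕ} (hr : 0 < r) :
    ∑ k : Fin r, (omega r ^ ((k : ℕ) * a))⁻¹ * omega r ^ (k : ℕ) * (omega r ^ (k : ℕ)) ^ n =
      if n + 1 ≡ a [MOD r] then (r : ℂ) else 0 := by
  have hω := omega_isPrimitiveRoot hr
  have h0 : omega r ≠ 0 := hω.ne_zero hr.ne'
  set ζ := omega r ^ (n + 1) / omega r ^ a with hζ
  have hterm : ∀ k : Fin r, (omega r ^ ((k : ℕ) * a))⁻¹ * omega r ^ (k : ℕ) *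
      (omega r ^ (k : ℕ)) ^ n = ζ ^ (k : ℕ) := by
    intro k
    rw [hζ, div_pow, ← pow_mul, ← pow_mul, ← pow_mul, mul_comm a, mul_assoc, ← pow_add,
      div_eq_inv_mul]
    congr 2
    ring
  simp only [hterm]
  have hone : ζ = 1 ↔ n + 1 ≡ a [MOD r] := by
    have h1 : ζ = omega r ^ (((n + 1 : ℕ) : ℤ) - (a : ℤ)) := by
      rw [zpow_sub₀ h0, zpow_natCast, zpow_natCast]
    rw [h1, hω.zpow_eq_one_iff_dvd, Nat.ModEq.comm, Nat.modEq_iff_dvd]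
  rw [Fin.sum_univ_eq_sum_range (fun k => ζ ^ k)]
  split_ifs with h
  · simp [hone.2 h]
  · rw [geom_sum_eq (fun h1 => h (hone.1 h1))]
    have : ζ ^ r = 1 := by
      rw [hζ, div_pow, ← pow_mul, ← pow_mul, mul_comm, mul_comm a, pow_mul, pow_mul,
        hω.pow_eq_one, one_pow, one_pow, div_one]
    rw [this, sub_self, zero_div]

theorem sum_integral_ray {r a n : ℕ} (hr : 0 < r) :
    ∑ k : Fin r, (omega r ^ ((k : ℕ) * a))⁻¹ * omega r ^ (k : ℕ) *
      ∫ t in Set.Ioi (0 : ℝ), (omega r ^ (k : ℕ) * (t : ℂ)) ^ n *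
        (Complex.exp (-(omega r ^ (k : ℕ) * (t : ℂ)) ^ r) / (2 * Real.pi)) = moment r a n := by
  simp only [integral_ray hr]
  simp only [← mul_assoc, mul_div_assoc']
  rw [← Finset.sum_mul, ← Finset.sum_div, sum_omega_pow hr, moment]
  have : (r : ℂ) ≠ 0 := by exact_mod_cast hr.ne'
  split_ifs
  · push_cast
    field_simp
  · simp

theorem contourIntegral_monomial {r a N : ℕ} (hr : 0 < r) (n : Fin N → ℕ) :
    contourIntegral r a N
      (fun x => ∏ i, (x i ^ n i * (Complex.exp (-(x i) ^ r) / (2 * Real.pi)))) =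
      ∏ i, moment r a (n i) := by
  simp only [← sum_integral_ray hr, contourIntegral]
  rw [Finset.prod_univ_sum]
  simp only [Fintype.piFinset_univ]
  refine Finset.sum_congr rfl fun j _ => ?_
  rw [MeasureTheory.volume_pi, MeasureTheory.Measure.restrict_pi_pi,
    MeasureTheory.integral_fintype_prod_eq_prod (fun i (t : ℝ) => (omega r ^ (j i : ℕ) * (t : ℂ)) ^ n i *
        (Complex.exp (-(omega r ^ (j i : ℕ) * (t : ℂ)) ^ r) / (2 * Real.pi))),
    ← Finset.prod_mul_distrib]

theorem integrableOn_monomial {r N : ℕ} (hr : 0 < r) (n : Fin N → ℕ) (j : Fin N → Fin r) :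
    MeasureTheory.IntegrableOn
      (fun t : Fin N → ℝ => ∏ i, ((omega r ^ (j i : ℕ) * (t i : ℂ)) ^ n i *
        (Complex.exp (-(omega r ^ (j i : ℕ) * (t i : ℂ)) ^ r) / (2 * Real.pi))))
      (Set.univ.pi fun _ : Fin N => Set.Ioi (0 : ℝ)) := by
  have hp := MeasureTheory.Integrable.fintype_prod
    (μ := fun _ : Fin N => MeasureTheory.volume.restrict (Set.Ioi (0 : ℝ)))
    (fun i => integrableOn_ray hr (n i) (j i))
  rwa [← MeasureTheory.Measure.restrict_pi_pi] at hp

theorem contourIntegral_sum_monomial {r a N : ℕ} (hr : 0 < r) {ι : Type*} (s : Finset ι)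
    (c : ι → ℂ) (n : ι → Fin N → ℕ) :
    contourIntegral r a N
      (fun x => ∑ k ∈ s, c k *
        ∏ i, (x i ^ n k i * (Complex.exp (-(x i) ^ r) / (2 * Real.pi)))) =
      ∑ k ∈ s, c k * ∏ i, moment r a (n k i) := by
  simp only [← contourIntegral_monomial hr, contourIntegral, Finset.mul_sum]
  rw [Finset.sum_comm]
  refine Finset.sum_congr rfl fun j _ => ?_
  rw [MeasureTheory.integral_finsetSum _
    (fun k _ => (integrableOn_monomial hr (n k) j).const_mul (c k)), Finset.mul_sum]
  refine Finset.sum_congr rfl fun k _ => ?_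
  rw [MeasureTheory.integral_const_mul]
  ring

theorem rowLen_bot (k : ℕ) : (⊥ : YoungDiagram).rowLen k = 0 := by
  by_contra h
  exact YoungDiagram.notMem_bot (k, 0)
    (YoungDiagram.mem_iff_lt_rowLen.2 (Nat.pos_of_ne_zero h))

theorem schur_bot (N : ℕ) : schur N ⊥ = 1 :=
  ((schur_unique N ⊥ 1).2 (mul_one _).symm).symm

theorem eval_alternant (N : ℕ) (lam : YoungDiagram) (x : Fin N → ℂ) :
    MvPolynomial.eval x (alternant N lam) =
      ∑ σ : Equiv.Perm (Fin N), ((Equiv.Perm.sign σ : ℤ) : ℂ) * ∏ i, x i ^ beta N lam (σ i) := by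
  rw [alternant, RingHom.map_det, ← Matrix.det_transpose, Matrix.det_apply']
  simp [beta]

theorem integrand_schur (r N : ℕ) (lam : YoungDiagram) (x : Fin N → ℂ) :
    integrand r N (schur N lam) x =
      ∑ p : Equiv.Perm (Fin N) × Equiv.Perm (Fin N),
        (((Equiv.Perm.sign p.1 : ℤ) : ℂ) * ((Equiv.Perm.sign p.2 : ℤ) : ℂ)) *
        ∏ i, (x i ^ (beta N lam (p.1 i) + beta N ⊥ (p.2 i)) *
          (Complex.exp (-(x i) ^ r) / (2 * Real.pi))) := by
  have h1 : ∏ i, ∏ j ∈ Finset.Iio i, (x i - x j) ^ 2 =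
      MvPolynomial.eval x (alternant N ⊥) * MvPolynomial.eval x (alternant N ⊥) := by
    rw [alternant_bot]
    simp only [map_prod, map_sub, MvPolynomial.eval_X, ← Finset.prod_mul_distrib]
    rw [Finset.prod_comm' (t' := Finset.univ) (s' := fun j => Finset.Ioi j) (by simp)]
    refine Finset.prod_congr rfl fun i _ => Finset.prod_congr rfl fun j _ => ?_
    ring
  have h2 : MvPolynomial.eval x (schur N lam) * MvPolynomial.eval x (alternant N ⊥) =
      MvPolynomial.eval x (alternant N lam) := by
    rw [(schur_unique N lam _).1 rfl, map_mul, mul_comm]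
  rw [integrand, h1]
  calc _ = MvPolynomial.eval x (schur N lam) * MvPolynomial.eval x (alternant N ⊥) *
        MvPolynomial.eval x (alternant N ⊥) *
        ∏ i, Complex.exp (-(x i) ^ r) / (2 * Real.pi) := by ring
    _ = _ := by
      rw [h2, eval_alternant, eval_alternant, Finset.sum_mul_sum, Fintype.sum_prod_type,
        Finset.sum_mul]
      refine Finset.sum_congr rfl fun σ _ => ?_
      rw [Finset.sum_mul]
      refine Finset.sum_congr rfl fun τ _ => ?_
      simp only [pow_add, Finset.prod_mul_distrib]
      ring

theorem ZInsert_schur {r a N : ℕ} (hr : 0 < r) (lam : YoungDiagram) :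
    ZInsert r a N (schur N lam) =
      Matrix.det (Matrix.of fun i j : Fin N => moment r a (beta N lam i + beta N ⊥ j)) := by
  set M : Matrix (Fin N) (Fin N) ℂ :=
    Matrix.of fun i j : Fin N => moment r a (beta N lam i + beta N ⊥ j) with hM
  rw [ZInsert, funext (integrand_schur r N lam), contourIntegral_sum_monomial hr,
    Fintype.sum_prod_type_right]
  have h : ∀ τ : Equiv.Perm (Fin N), ∑ σ : Equiv.Perm (Fin N),
      (((Equiv.Perm.sign σ : ℤ) : ℂ) * ((Equiv.Perm.sign τ : ℤ) : ℂ)) *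
        ∏ i, moment r a (beta N lam (σ i) + beta N ⊥ (τ i)) = M.det := by
    intro τ
    have h1 := Matrix.det_permute' τ M
    have h2 : ((Equiv.Perm.sign τ : ℤ) : ℂ) * ((Equiv.Perm.sign τ : ℤ) : ℂ) = 1 := by
      rw [← Int.cast_mul, ← Units.val_mul, Int.units_mul_self]
      simp
    calc _ = ((Equiv.Perm.sign τ : ℤ) : ℂ) * (M.submatrix id τ).det := by
          rw [Matrix.det_apply', Finset.mul_sum]
          refine Finset.sum_congr rfl fun σ _ => ?_
          simp only [hM, Matrix.submatrix_apply, Matrix.of_apply, id]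
          ring
      _ = M.det := by rw [h1, ← mul_assoc, h2, one_mul]
  rw [Finset.sum_congr rfl fun τ _ => h τ, Finset.sum_const, Finset.card_univ,
    Fintype.card_perm, Fintype.card_fin, nsmul_eq_mul, one_div, inv_mul_cancel_left₀]
  exact_mod_cast N.factorial_ne_zero

/-! ### Evaluation of the moment determinant -/

theorem exists_det_eval_eq_mul_prod_sub {S : Type*} [Fintype S] [LinearOrder S]
    (p : S → Polynomial ℂ) (hp : ∀ j, (p j).natDegree < Fintype.card S) :
    ∃ C : ℂ, ∀ H : S → ℂ, (Matrix.of fun i j => (p j).eval (H i)).det =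
      C * ∏ i, ∏ j, if i < j then H i - H j else 1 := by
  set n := Fintype.card S with hn
  let e : Fin n ≃o S := monoEquivOfFin S hn.symm
  refine ⟨(Matrix.of fun i j : Fin n => (p (e j)).coeff i).det *
    ∏ i : S, ∏ j : S, if i < j then -1 else 1, fun H => ?_⟩
  have h1 : (Matrix.of fun i j => (p j).eval (H i)).submatrix e e =
      Matrix.vandermonde (fun i => H (e i)) *
        (Matrix.of fun i j : Fin n => (p (e j)).coeff i) := by
    ext i j
    simp only [Matrix.submatrix_apply, Matrix.of_apply, Matrix.mul_apply,
      Matrix.vandermonde_apply]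
    rw [Polynomial.eval_eq_sum_range' (hp _), ← Fin.sum_univ_eq_sum_range
      (fun m => (p (e j)).coeff m * H (e i) ^ m)]
    exact Finset.sum_congr rfl fun m _ => mul_comm _ _
  have h2 := Matrix.det_submatrix_equiv_self e.toEquiv (Matrix.of fun i j => (p j).eval (H i))
  have h3 : (Matrix.of fun i j => (p j).eval (H i)).submatrix e.toEquiv e.toEquiv =
      (Matrix.of fun i j => (p j).eval (H i)).submatrix e e := rfl
  have h4 : (Matrix.vandermonde fun i => H (e i)).det =
      ∏ i, ∏ j, if i < j then H j - H i else 1 := by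
    rw [Matrix.det_vandermonde, ← e.toEquiv.prod_comp]
    refine Finset.prod_congr rfl fun i _ => ?_
    rw [← e.toEquiv.prod_comp, ← Finset.prod_filter_mul_prod_filter_not Finset.univ (i < ·)]
    rw [Finset.prod_congr rfl (s₂ := Finset.univ.filter (i < ·))
      (g := fun j => H (e j) - H (e i)), Finset.prod_congr rfl
      (s₂ := Finset.univ.filter (¬ i < ·)) (g := fun _ => 1)]
    · rw [Finset.prod_const_one, mul_one]
      exact Finset.prod_congr (by ext; simp) fun _ _ => rfl
    · intro j hj
      simpa using fun h => absurd h (by simpa using hj)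
    · intro j hj
      simp [(Finset.mem_filter.1 hj).2]
  rw [← h2, h3, h1, Matrix.det_mul, h4, mul_comm _ (Matrix.det _), mul_assoc]
  simp only [← Finset.prod_mul_distrib]
  congr 1
  refine Finset.prod_congr rfl fun i _ => Finset.prod_congr rfl fun j _ => ?_
  split_ifs <;> ring

theorem exists_det_block_eval_eq_mul_prod_sub {N : ℕ} (b : Fin N → ℕ) (p : Fin N → Polynomial ℂ)
    (hp : ∀ j, (p j).natDegree < Fintype.card {i // b i = b j}) :
    ∃ C : ℂ, ∀ H : Fin N → ℂ,
      (Matrix.of fun i j => if b i = b j then (p j).eval (H i) else 0).det =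
        C * ∏ j, ∏ i ∈ Finset.Iio j, if b i = b j then H i - H j else 1 := by
  have hblock : ∀ c : ℕ, ∃ C : ℂ, ∀ H : Fin N → ℂ,
      (Matrix.of fun i j : {i // b i = c} => (p j).eval (H i)).det =
        C * ∏ i : {i // b i = c}, ∏ j : {i // b i = c}, if i < j then H i - H j else 1 := by
    intro c
    obtain ⟨C, hC⟩ := exists_det_eval_eq_mul_prod_sub (S := {i // b i = c}) (fun j => p j)
      (fun j => by
        have := hp j
        rwa [j.2] at this)
    exact ⟨C, fun H => hC fun i => H i⟩
  choose C hC using hblock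
  refine ⟨∏ c ∈ Finset.univ.image b, C c, fun H => ?_⟩
  have htri : (Matrix.of fun i j => if b i = b j then (p j).eval (H i) else 0).BlockTriangular b :=
    fun i j hij => by simp [hij.ne']
  rw [htri.det]
  have h1 : ∀ c, ((Matrix.of fun i j => if b i = b j then (p j).eval (H i) else 0).toSquareBlock
      b c).det = C c * ∏ i with b i = c, ∏ j, if i < j ∧ b i = b j then H i - H j else 1 := by
    intro c
    have h2 : (Matrix.of fun i j => if b i = b j then (p j).eval (H i) else 0).toSquareBlock b c =
        Matrix.of fun i j : {i // b i = c} => (p j).eval (H i) := by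
      ext i j
      simp [Matrix.toSquareBlock_def, i.2, j.2]
    rw [h2, hC]
    congr 1
    rw [Finset.prod_subtype (p := fun i => b i = c) _ (by simp)]
    refine Finset.prod_congr rfl fun i _ => ?_
    rw [← Finset.prod_filter_mul_prod_filter_not Finset.univ (fun j => b j = c),
      Finset.prod_congr rfl (s₂ := Finset.univ.filter fun j => ¬ b j = c) (g := fun _ => 1),
      Finset.prod_const_one, mul_one, Finset.prod_subtype (p := fun i => b i = c) _ (by simp)]
    · refine Finset.prod_congr rfl fun j _ => ?_
      simp [i.2, j.2]
    · intro j hj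
      rw [if_neg]
      rintro ⟨-, h⟩
      exact (Finset.mem_filter.1 hj).2 (h ▸ i.2)
  simp only [h1]
  rw [Finset.prod_mul_distrib, Finset.prod_fiberwise_of_maps_to (fun i _ => by simp)]
  congr 1
  rw [Finset.prod_comm]
  refine Finset.prod_congr rfl fun j _ => ?_
  rw [← Finset.prod_filter_mul_prod_filter_not Finset.univ (· < j),
    Finset.prod_congr rfl (s₂ := Finset.univ.filter (¬ · < j)) (g := fun _ => 1),
    Finset.prod_const_one, mul_one]
  · refine Finset.prod_congr (by ext; simp) fun i hi => ?_
    simp [(Finset.mem_Iio.1 hi)]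
  · intro i hi
    simp [(Finset.mem_filter.1 hi).2]

/-- The ratio of consecutive values of `Γ` along the progression `a mod r`. -/
noncomputable def stepFactor (r a n : ℕ) : ℝ := if n ≡ a [MOD r] then (n : ℝ) / r else 1

theorem exists_Gamma_eq_mul_prod_stepFactor {r a : ℕ} (hr : 0 < r) (ha : a < r) :
    ∃ G : ℝ, ∀ h c : ℕ, c < r → h + c + 1 ≡ a [MOD r] →
      Real.Gamma ((h + c + 1 : ℕ) / r) = G * ∏ n ∈ Finset.range h, stepFactor r a (n + 1) := by
  refine ⟨Real.Gamma ((if a = 0 then r else a : ℕ) / r), fun h => ?_⟩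
  induction h with
  | zero =>
    intro c hc hmod
    have : 0 + c + 1 = if a = 0 then r else a := by
      rw [Nat.ModEq, Nat.mod_eq_of_lt ha] at hmod
      rcases Nat.lt_or_ge (0 + c + 1) r with h1 | h1
      · rw [Nat.mod_eq_of_lt h1] at hmod
        rw [if_neg (by omega)]
        exact hmod
      · have h2 : 0 + c + 1 = r := by omega
        rw [h2, Nat.mod_self] at hmod
        rw [if_pos hmod.symm, h2]
    rw [this]
    simp
  | succ h ih =>
    intro c hc hmod
    rw [Finset.prod_range_succ]
    have hr0 : (r : ℝ) ≠ 0 := by exact_mod_cast hr.ne'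
    rcases Nat.lt_or_ge (c + 1) r with h1 | h1
    · have e : h + 1 + c + 1 = h + (c + 1) + 1 := by ring
      rw [e] at hmod ⊢
      have hne : ¬ h + 1 ≡ a [MOD r] := by
        intro h2
        have h3 : (h + 1) + (c + 1) ≡ (h + 1) + 0 [MOD r] := by
          refine Nat.ModEq.trans ?_ h2.symm
          rwa [show h + 1 + (c + 1) = h + (c + 1) + 1 by ring]
        have h4 := Nat.ModEq.add_left_cancel' _ h3
        rw [Nat.ModEq, Nat.mod_eq_of_lt h1, Nat.zero_mod] at h4
        omega
      rw [ih (c + 1) h1 hmod, stepFactor, if_neg hne, mul_one]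
    · have hc' : c + 1 = r := by omega
      have e : h + 1 + c + 1 = (h + 1) + r := by omega
      have h2 : h + 0 + 1 ≡ a [MOD r] := by
        rw [e] at hmod
        exact (Nat.add_modEq_right).symm.trans hmod
      rw [stepFactor, if_pos h2, e, Nat.cast_add, add_div, div_self hr0,
        Real.Gamma_add_one (by positivity), ← mul_assoc, ← ih 0 hr h2, add_zero, mul_comm]

theorem Gamma_add_natCast {x : ℝ} (hx : 0 < x) (v : ℕ) :
    Real.Gamma (x + v) = Real.Gamma x * ∏ t ∈ Finset.range v, (x + t) := by
  induction v with
  | zero => simp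
  | succ v ih =>
    rw [Nat.cast_succ, ← add_assoc, Real.Gamma_add_one (by positivity), ih,
      Finset.prod_range_succ]
    ring

theorem exists_moment_eq_mul_eval {r a : ℕ} (hr : 0 < r) (ha : a < r) (k : ℕ) :
    ∃ p : Polynomial ℂ, p.natDegree ≤ k / r ∧ ∀ h : ℕ, h + k + 1 ≡ a [MOD r] →
      moment r a (h + k) =
        ((∏ n ∈ Finset.range h, stepFactor r a (n + 1) : ℝ) : ℂ) * p.eval (h : ℂ) := by
  obtain ⟨G, hG⟩ := exists_Gamma_eq_mul_prod_stepFactor hr ha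
  refine ⟨Polynomial.C ((G / (2 * Real.pi) : ℝ) : ℂ) * ∏ t ∈ Finset.range (k / r),
    (Polynomial.C (1 / r : ℂ) * Polynomial.X + Polynomial.C (((k % r + 1 : ℕ) / r : ℂ) + t)),
    ?_, fun h hmod => ?_⟩
  · refine (Polynomial.natDegree_C_mul_le _ _).trans ((Polynomial.natDegree_prod_le _ _).trans ?_)
    refine (Finset.sum_le_card_nsmul _ _ 1 fun t _ => ?_).trans (by simp)
    exact Polynomial.natDegree_linear_le
  · have hr0 : (r : ℝ) ≠ 0 := by exact_mod_cast hr.ne'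
    have hmod' : h + k % r + 1 ≡ a [MOD r] :=
      (((Nat.mod_modEq k r).add_left h).add_right 1).trans hmod
    have e : ((h + k + 1 : ℕ) : ℝ) / r = ((h + k % r + 1 : ℕ) : ℝ) / r + (k / r : ℕ) := by
      have : h + k + 1 = (h + k % r + 1) + r * (k / r) := by
        have := Nat.mod_add_div k r
        omega
      rw [this, Nat.cast_add, Nat.cast_mul, add_div, mul_div_cancel_left₀ _ hr0]
    rw [moment, if_pos hmod, e, Gamma_add_natCast (by positivity),
      hG h _ (Nat.mod_lt _ hr) hmod']
    simp only [Polynomial.eval_mul, Polynomial.eval_C, Polynomial.eval_prod, Polynomial.eval_add,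
      Polynomial.eval_X]
    have h2 : ((∏ t ∈ Finset.range (k / r), (((h + k % r + 1 : ℕ) : ℝ) / r + t) : ℝ) : ℂ) =
        ∏ t ∈ Finset.range (k / r), (1 / (r : ℂ) * h + (((k % r + 1 : ℕ) : ℂ) / r + t)) := by
      push_cast
      refine Finset.prod_congr rfl fun t _ => ?_
      ring
    rw [← h2]
    push_cast
    ring

theorem beta_bot (N : ℕ) (i : Fin N) : beta N ⊥ i = N - 1 - (i : ℕ) := by
  rw [beta, rowLen_bot, zero_add]

theorem exists_det_moment_eq {r a N : ℕ} (hr : 0 < r) (ha : a < r) (σ : Equiv.Perm (Fin N))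
    (hσ : ∀ i, beta N ⊥ i + beta N ⊥ (σ i) + 1 ≡ a [MOD r]) :
    ∃ C : ℂ, ∀ H : Fin N → ℕ, (∀ i, H i ≡ beta N ⊥ i [MOD r]) →
      (Matrix.of fun i j => moment r a (H i + beta N ⊥ (σ j))).det =
        C * ((∏ i, ∏ n ∈ Finset.range (H i), stepFactor r a (n + 1) : ℝ) : ℂ) *
          ∏ j, ∏ i ∈ Finset.Iio j,
            if beta N ⊥ i % r = beta N ⊥ j % r then (H i : ℂ) - H j else 1 := by
  choose p hdeg hp using fun k => exists_moment_eq_mul_eval hr ha k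
  obtain ⟨C, hC⟩ := exists_det_block_eval_eq_mul_prod_sub (fun i => beta N ⊥ i % r)
    (fun j => p (beta N ⊥ (σ j))) (by
      intro j
      refine (Nat.lt_succ_of_le (hdeg _)).trans_le ?_
      set K := beta N ⊥ (σ j) with hK
      have hKN : K < N := by
        have := (σ j).2
        rw [hK, beta_bot]
        omega
      have hKr : r * (K / r) ≤ K := Nat.mul_div_le K r
      have hle : ∀ t : Fin (K / r + 1), r * (t : ℕ) ≤ K := fun t =>
        (Nat.mul_le_mul_left r (Nat.lt_succ_iff.1 t.2)).trans hKr
      let idx : Fin (K / r + 1) → Fin N := fun t => ⟨N - 1 - (K - r * t), by omega⟩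
      have hidx : ∀ t, beta N ⊥ (idx t) = K - r * t := by
        intro t
        have := hle t
        simp only [beta_bot, idx]
        omega
      rw [← Fintype.card_fin (K / r).succ]
      refine Fintype.card_le_of_injective (fun t => ⟨σ.symm (idx t), ?_⟩) ?_
      · have h1 := hσ (σ.symm (idx t))
        rw [Equiv.apply_symm_apply, hidx, add_assoc] at h1
        have h2 := hσ j
        rw [← hK, add_assoc] at h2
        have h3 : K - r * t + 1 ≡ K + 1 [MOD r] := by
          refine Nat.ModEq.add_right 1 ?_
          have := hle t
          exact (Nat.modEq_iff_dvd' (by omega)).2 ⟨t, by omega⟩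
        exact Nat.ModEq.add_right_cancel h3 (h1.trans h2.symm)
      · intro t s hts
        have h1 : idx t = idx s := σ.symm.injective (Subtype.ext_iff.1 hts)
        have h2 := hidx t
        rw [h1, hidx s] at h2
        have h3 := hle t
        have h4 := hle s
        have h5 : r * (t : ℕ) = r * s := by omega
        exact Fin.ext (Nat.eq_of_mul_eq_mul_left hr h5))
  refine ⟨C, fun H hH => ?_⟩
  have h1 : (Matrix.of fun i j => moment r a (H i + beta N ⊥ (σ j))) =
      Matrix.of fun i j => ((∏ n ∈ Finset.range (H i), stepFactor r a (n + 1) : ℝ) : ℂ) *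
        (Matrix.of fun i j => if beta N ⊥ i % r = beta N ⊥ j % r then
          (p (beta N ⊥ (σ j))).eval ((H i : ℕ) : ℂ) else 0) i j := by
    ext i j
    simp only [Matrix.of_apply]
    have h3 : H i + beta N ⊥ (σ j) + 1 ≡ beta N ⊥ i + beta N ⊥ (σ j) + 1 [MOD r] :=
      ((hH i).add_right _).add_right _
    split_ifs with h2
    · have h2' : beta N ⊥ i ≡ beta N ⊥ j [MOD r] := h2
      exact hp _ _ (h3.trans (((h2'.add_right _).add_right _).trans (hσ j)))
    · rw [moment, if_neg, mul_zero]
      intro h4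
      refine h2 (Nat.ModEq.add_right_cancel' (beta N ⊥ (σ j) + 1) ?_)
      have := (h3.symm.trans h4).trans (hσ j).symm
      simpa [add_assoc] using this
  rw [h1, Matrix.det_mul_column, hC fun i => (H i : ℂ)]
  push_cast
  ring

/-! ### Products over contents and hook lengths -/

@[to_additive]
theorem prod_cells {M : Type*} [CommMonoid M] {N : ℕ} {lam : YoungDiagram}
    (hlam : lam.colLen 0 ≤ N) (f : ℕ × ℕ → M) :
    ∏ x ∈ lam.cells, f x = ∏ i : Fin N, ∏ y ∈ Finset.range (lam.rowLen i), f (i, y) := by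
  rw [Finset.prod_fin_eq_prod_range, ← Finset.prod_fiberwise_of_maps_to (g := Prod.fst)
    (t := Finset.range N)]
  · refine Finset.prod_congr rfl fun i hi => ?_
    rw [dif_pos (Finset.mem_range.1 hi)]
    refine Finset.prod_bij' (fun x _ => x.2) (fun y _ => (i, y)) ?_ ?_ ?_ ?_ ?_
    · rintro ⟨a, b⟩ hx
      obtain ⟨h1, rfl⟩ := Finset.mem_filter.1 hx
      exact Finset.mem_range.2 (YoungDiagram.mem_iff_lt_rowLen.1 h1)
    · intro y hy
      exact Finset.mem_filter.2
        ⟨YoungDiagram.mem_iff_lt_rowLen.2 (Finset.mem_range.1 hy), rfl⟩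
    · rintro ⟨a, b⟩ hx
      obtain ⟨h1, rfl⟩ := Finset.mem_filter.1 hx
      rfl
    · intro y hy
      rfl
    · rintro ⟨a, b⟩ hx
      obtain ⟨h1, rfl⟩ := Finset.mem_filter.1 hx
      rfl
  · rintro ⟨a, b⟩ hx
    have h1 : (a, 0) ∈ lam := lam.up_left_mem le_rfl (Nat.zero_le b) hx
    exact Finset.mem_range.2 ((YoungDiagram.mem_iff_lt_colLen.1 h1).trans_le hlam)

theorem colLen_bot_le (N : ℕ) : (⊥ : YoungDiagram).colLen 0 ≤ N := by
  by_contra! h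
  exact YoungDiagram.notMem_bot (N, 0) (YoungDiagram.mem_iff_lt_colLen.2 h)

theorem beta_eq_add (N : ℕ) (lam : YoungDiagram) (i : Fin N) :
    beta N lam i = beta N ⊥ i + lam.rowLen i := by
  rw [beta_bot, beta, add_comm]

theorem add_content_eq {N : ℕ} (i : Fin N) (y : ℕ) :
    (N : ℤ) + content (i, y) = ((beta N ⊥ i + y : ℕ) : ℤ) + 1 := by
  have := i.2
  simp only [content, beta_bot]
  omega

theorem prod_content_mul {M : Type*} [CommMonoid M] {N : ℕ} {lam : YoungDiagram}
    (hlam : lam.colLen 0 ≤ N) (f : ℤ → M) :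
    (∏ x ∈ lam.cells, f (N + content x)) * ∏ i, ∏ n ∈ Finset.range (beta N ⊥ i), f ((n : ℤ) + 1) =
      ∏ i, ∏ n ∈ Finset.range (beta N lam i), f ((n : ℤ) + 1) := by
  rw [prod_cells hlam, ← Finset.prod_mul_distrib]
  refine Finset.prod_congr rfl fun i _ => ?_
  rw [beta_eq_add N lam, Finset.prod_range_add, mul_comm]
  simp only [add_content_eq]

theorem sum_content_sub {N : ℕ} {lam : YoungDiagram} (hlam : lam.colLen 0 ≤ N) (G : ℤ → ℤ) :
    ∑ x ∈ lam.cells, (G (N + content x) - G (N + content x - 1)) =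
      ∑ i, (G (beta N lam i) - G (beta N ⊥ i)) := by
  rw [sum_cells hlam]
  refine Finset.sum_congr rfl fun i _ => ?_
  simp only [add_content_eq, add_sub_cancel_right]
  have h := Finset.sum_range_sub (fun y : ℕ => G ((beta N ⊥ i + y : ℕ) : ℤ)) (lam.rowLen i)
  rw [add_zero, ← beta_eq_add] at h
  rw [← h]
  refine Finset.sum_congr rfl fun y _ => ?_
  push_cast
  ring_nf

theorem card_eq_sum_beta_sub {N : ℕ} {lam : YoungDiagram} (hlam : lam.colLen 0 ≤ N) :
    (lam.card : ℤ) = ∑ i, ((beta N lam i : ℤ) - beta N ⊥ i) := by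
  have h := sum_content_sub hlam id
  simpa using h

theorem beta_strictAnti (N : ℕ) (lam : YoungDiagram) : StrictAnti (beta N lam) := by
  intro i j hij
  have h1 := lam.rowLen_anti i j (Fin.lt_def.1 hij).le
  have h2 := j.2
  have h3 := Fin.lt_def.1 hij
  simp only [beta]
  omega

theorem lt_colLen_iff_lt_rowLen (lam : YoungDiagram) (i j : ℕ) :
    i < lam.colLen j ↔ j < lam.rowLen i := by
  rw [← YoungDiagram.mem_iff_lt_colLen, YoungDiagram.mem_iff_lt_rowLen]

theorem prod_hookLength_row {M : Type*} [CommMonoid M] {N : ℕ} {lam : YoungDiagram}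
    (hlam : lam.colLen 0 ≤ N) (f : ℤ → M) (i : Fin N) :
    (∏ y ∈ Finset.range (lam.rowLen i), f (hookLength lam (i, y))) *
        ∏ j ∈ Finset.Ioi i, f ((beta N lam i : ℤ) - beta N lam j) =
      ∏ n ∈ Finset.range (beta N lam i), f ((n : ℤ) + 1) := by
  have key := lt_colLen_iff_lt_rowLen lam
  have hcol : ∀ y, lam.colLen y ≤ N := fun y => (lam.colLen_anti 0 y (Nat.zero_le y)).trans hlam
  have hiN := i.2
  refine (Finset.prod_disjSum (Finset.range (lam.rowLen i)) (Finset.Ioi i)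
    (Sum.elim (fun y => f (hookLength lam (i, y)))
      (fun j => f ((beta N lam i : ℤ) - beta N lam j)))).symm.trans ?_
  let e : ℕ ⊕ Fin N → ℕ := Sum.elim (fun y => (hookLength lam (i, y) - 1).toNat)
      (fun j => beta N lam i - beta N lam j - 1)
  have he : ∀ z ∈ (Finset.range (lam.rowLen i)).disjSum (Finset.Ioi i),
      e z < beta N lam i ∧ Sum.elim (fun y => (hookLength lam (i, y)))
      (fun j => ((beta N lam i : ℤ) - beta N lam j)) z = (e z : ℤ) + 1 := by
    rintro (y | j) hz
    · rw [Finset.inl_mem_disjSum, Finset.mem_range] at hz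
      have h1 := (key i y).2 hz
      have h2 := hcol y
      simp only [e, Sum.elim_inl, hookLength, beta]
      omega
    · rw [Finset.inr_mem_disjSum, Finset.mem_Ioi] at hz
      have h1 := beta_strictAnti N lam hz
      simp only [e, Sum.elim_inr]
      omega
  have hinj : Set.InjOn e ((Finset.range (lam.rowLen i)).disjSum (Finset.Ioi i)) := by
    intro z hz w hw hzw
    have h1 := (he z hz).2
    have h2 := (he w hw).2
    rw [hzw, ← h2] at h1
    clear h2 hzw
    rcases z with y | j <;> rcases w with y' | j' <;>
      simp only [Finset.mem_coe, Finset.inl_mem_disjSum,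
        Finset.inr_mem_disjSum, Finset.mem_range, Finset.mem_Ioi] at hz hw <;>
      simp only [Sum.elim_inl, Sum.elim_inr, hookLength, beta] at h1
    · have h3 := lam.colLen_anti y y'
      have h4 := lam.colLen_anti y' y
      congr 1
      omega
    · have h3 := key j' y
      have := j'.2
      omega
    · have h3 := key j y'
      have := j.2
      omega
    · have h3 : beta N lam j = beta N lam j' := by
        simp only [beta]
        omega
      rw [(beta_strictAnti N lam).injective h3]
  have himage : ((Finset.range (lam.rowLen i)).disjSum (Finset.Ioi i)).image e =
      Finset.range (beta N lam i) := by
    refine Finset.eq_of_subset_of_card_le ?_ ?_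
    · intro n hn
      obtain ⟨z, hz, rfl⟩ := Finset.mem_image.1 hn
      exact Finset.mem_range.2 (he z hz).1
    · rw [Finset.card_image_of_injOn hinj, Finset.card_disjSum, Finset.card_range,
        Finset.card_range, Fin.card_Ioi, beta]
  rw [← himage, Finset.prod_image hinj]
  refine Finset.prod_congr rfl fun z hz => ?_
  rw [← (he z hz).2]
  rcases z with y | j <;> rfl

theorem prod_hookLength_mul {M : Type*} [CommMonoid M] {N : ℕ} {lam : YoungDiagram}
    (hlam : lam.colLen 0 ≤ N) (f : ℤ → M) :
    (∏ x ∈ lam.cells, f (hookLength lam x)) *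
        ∏ j, ∏ i ∈ Finset.Iio j, f ((beta N lam i : ℤ) - beta N lam j) =
      ∏ i, ∏ n ∈ Finset.range (beta N lam i), f ((n : ℤ) + 1) := by
  rw [prod_cells hlam, Finset.prod_comm' (t' := Finset.univ) (s' := fun i => Finset.Ioi i)
    (by simp), ← Finset.prod_mul_distrib]
  exact Finset.prod_congr rfl fun i _ => prod_hookLength_row hlam f i

theorem prod_hookLength_mul_eq_prod_content_mul {M : Type*} [CommMonoid M] {N : ℕ}
    {lam : YoungDiagram} (hlam : lam.colLen 0 ≤ N) (f : ℤ → M) :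
    (∏ x ∈ lam.cells, f (hookLength lam x)) *
        ∏ j, ∏ i ∈ Finset.Iio j, f ((beta N lam i : ℤ) - beta N lam j) =
      (∏ x ∈ lam.cells, f (N + content x)) *
        ∏ j, ∏ i ∈ Finset.Iio j, f ((beta N ⊥ i : ℤ) - beta N ⊥ j) := by
  rw [prod_hookLength_mul hlam, ← prod_content_mul hlam, ← prod_hookLength_mul (colLen_bot_le N)]
  simp

theorem hookLength_pos {lam : YoungDiagram} {x : ℕ × ℕ} (hx : x ∈ lam) :
    0 < hookLength lam x := by
  have h1 := YoungDiagram.mem_iff_lt_rowLen.1 (show (x.1, x.2) ∈ lam from hx)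
  have h2 := YoungDiagram.mem_iff_lt_colLen.1 (show (x.1, x.2) ∈ lam from hx)
  simp only [hookLength]
  omega

theorem add_content_pos {N : ℕ} {lam : YoungDiagram} (hlam : lam.colLen 0 ≤ N) {x : ℕ × ℕ}
    (hx : x ∈ lam) : 0 < (N : ℤ) + content x := by
  have h1 : (x.1, 0) ∈ lam := lam.up_left_mem le_rfl (Nat.zero_le x.2) hx
  have h2 := (YoungDiagram.mem_iff_lt_colLen.1 h1).trans_le hlam
  simp only [content]
  omega

theorem bracket_ne_zero {r a : ℕ} {n : ℤ} (hn : n ≠ 0) : bracket r a n ≠ 0 := by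
  rw [bracket]
  split_ifs
  exacts [hn, one_ne_zero]

/-! ### Signs -/

/-- The odd function `(-1)^⌊n/r⌋ ⟦n⟧_{r,0}`. -/
def signedBracket (r : ℕ) (n : ℤ) : ℤ := (Int.negOnePow (n / (r : ℤ)) : ℤ) * bracket r 0 n

theorem signedBracket_neg {r : ℕ} (hr : 0 < r) (n : ℤ) :
    signedBracket r (-n) = -signedBracket r n := by
  have hr0 : (r : ℤ) ≠ 0 := by exact_mod_cast hr.ne'
  simp only [signedBracket, bracket, Nat.cast_zero, Int.modEq_zero_iff_dvd, dvd_neg]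
  split_ifs with h
  · obtain ⟨m, rfl⟩ := h
    rw [← mul_neg, Int.mul_ediv_cancel_left _ hr0, Int.mul_ediv_cancel_left _ hr0,
      Int.negOnePow_neg]
    ring
  · have h1 : -n / (r : ℤ) = -(n / r) - 1 := by
      have h2 := Int.emod_add_mul_ediv n r
      have h3 := Int.emod_lt_of_pos n (show (0 : ℤ) < r by exact_mod_cast hr)
      have h4 := Int.emod_nonneg n hr0
      have h5 : n % r ≠ 0 := fun h6 => h (Int.dvd_of_emod_eq_zero h6)
      have h6 : (r : ℤ) * (-(n / r) - 1) = -(r * (n / r)) - r := by ring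
      refine ((Int.ediv_emod_unique (r := r - n % r) (by exact_mod_cast hr)).2
        ⟨?_, ?_, ?_⟩).1
      · rw [h6]
        omega
      · omega
      · omega
    rw [h1, Int.negOnePow_sub, Int.negOnePow_neg]
    simp

theorem sum_sum_Iio_add {N : ℕ} (d : Fin N → ℤ) :
    ∑ j, ∑ i ∈ Finset.Iio j, (d i + d j) = ((N : ℤ) - 1) * ∑ i, d i := by
  simp only [Finset.sum_add_distrib]
  rw [Finset.sum_comm' (t' := Finset.univ) (s' := fun i => Finset.Ioi i) (by simp),
    ← Finset.sum_add_distrib, Finset.mul_sum]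
  refine Finset.sum_congr rfl fun i _ => ?_
  have := i.2
  rw [Finset.sum_const, Finset.sum_const, Fin.card_Ioi, Fin.card_Iio, nsmul_eq_mul, nsmul_eq_mul,
    ← add_mul]
  congr 1
  omega

theorem prod_negOnePow {ι : Type*} (s : Finset ι) (d : ι → ℤ) :
    ∏ i ∈ s, ((d i).negOnePow : ℤ) = ((∑ i ∈ s, d i).negOnePow : ℤ) := by
  classical
  induction s using Finset.induction_on with
  | empty => simp
  | insert i s hi ih =>
    rw [Finset.prod_insert hi, Finset.sum_insert hi, Int.negOnePow_add, ih, Units.val_mul]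

/-! ### Cores and residues of the exponents -/

theorem rowLen_eq_of_cells_eq_sdiff_rimHook {lam mu : YoungDiagram} {i j : ℕ}
    (hmu : mu.cells = lam.cells \ rimHook lam (i, j)) (m : ℕ) :
    mu.rowLen m = if m < i ∨ lam.colLen j ≤ m then lam.rowLen m
      else if m + 1 = lam.colLen j then j else lam.rowLen (m + 1) - 1 := by
  have hmem : ∀ y, y < mu.rowLen m ↔
      y < lam.rowLen m ∧ ¬ (i ≤ m ∧ j ≤ y ∧ ¬ y + 1 < lam.rowLen (m + 1)) := by
    intro y
    rw [← YoungDiagram.mem_iff_lt_rowLen, ← YoungDiagram.mem_cells, hmu, Finset.mem_sdiff,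
      rimHook, Finset.mem_filter, YoungDiagram.mem_cells, YoungDiagram.mem_iff_lt_rowLen,
      YoungDiagram.mem_iff_lt_rowLen]
    tauto
  have h1 := lt_colLen_iff_lt_rowLen lam m j
  have h2 := lt_colLen_iff_lt_rowLen lam (m + 1) j
  have h3 := lam.rowLen_anti m (m + 1) (Nat.le_succ m)
  refine eq_of_forall_lt_iff fun y => ?_
  rw [hmem]
  split_ifs <;> omega

theorem isLowerSet_sdiff_rimHook (lam : YoungDiagram) (x : ℕ × ℕ) :
    IsLowerSet (↑(lam.cells \ rimHook lam x) : Set (ℕ × ℕ)) := by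
  rintro y z hzy hy
  simp only [rimHook, Finset.coe_sdiff, Set.mem_sdiff, Finset.mem_coe, Finset.mem_filter,
    YoungDiagram.mem_cells] at hy ⊢
  have hz : z ∈ lam := lam.up_left_mem hzy.1 hzy.2 hy.1
  refine ⟨hz, fun ⟨_, h1, h2, h3⟩ => hy.2 ⟨hy.1, h1.trans hzy.1, h2.trans hzy.2, fun h4 => h3 ?_⟩⟩
  exact lam.up_left_mem (Nat.succ_le_succ hzy.1) (Nat.succ_le_succ hzy.2) h4

theorem colLen_le_of_cells_subset {lam mu : YoungDiagram} {N : ℕ} (h : mu.cells ⊆ lam.cells)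
    (hlam : lam.colLen 0 ≤ N) : mu.colLen 0 ≤ N := by
  by_contra! h1
  have h2 : (N, 0) ∈ lam := h (YoungDiagram.mem_iff_lt_colLen.2 h1)
  exact absurd (YoungDiagram.mem_iff_lt_colLen.1 h2) (by omega)

/-- Stripping a rim hook of length `r` replaces one of the exponents `h` by `h - r`. -/
theorem beta_of_cells_eq_sdiff_rimHook {N : ℕ} {lam mu : YoungDiagram} (hlam : lam.colLen 0 ≤ N)
    {i l : Fin N} {j : ℕ} (hx : ((i : ℕ), j) ∈ lam) (hl : (l : ℕ) + 1 = lam.colLen j)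
    (hmu : mu.cells = lam.cells \ rimHook lam (i, j)) :
    (∀ m, m ≠ l → beta N mu m = beta N lam (Fin.cycleIcc i l m)) ∧
      beta N mu l = j + (N - 1 - l) ∧
      (rimHook lam (i, j)).card + (j + (N - 1 - l)) = beta N lam i := by
  have : NeZero N := ⟨by have := i.2; omega⟩
  have hil : i ≤ l := by
    have := YoungDiagram.mem_iff_lt_colLen.1 hx
    exact Fin.le_def.2 (by omega)
  have hrow := rowLen_eq_of_cells_eq_sdiff_rimHook hmu
  have hbeta : ∀ m, m ≠ l → beta N mu m = beta N lam (Fin.cycleIcc i l m) := by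
    intro m hm
    rw [beta, hrow]
    rcases lt_or_ge m i with h1 | h1
    · rw [Fin.cycleIcc_of_lt h1, if_pos (Or.inl (Fin.lt_def.1 h1)), beta]
    rcases lt_or_gt_of_ne hm with h2 | h2
    · have hv : ((m + 1 : Fin N) : ℕ) = m + 1 := by
        have h3 := l.2
        have h4 := Fin.lt_def.1 h2
        exact Fin.val_add_one_of_lt' (by omega)
      have h4 := Fin.lt_def.1 h2
      have h5 := Fin.le_def.1 h1
      have h6 := (lt_colLen_iff_lt_rowLen lam (m + 1) j).1 (by omega)
      have h7 := l.2
      rw [Fin.cycleIcc_of_ge_of_lt h1 h2, if_neg (by omega), if_neg (by omega), beta, hv]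
      omega
    · have h4 := Fin.lt_def.1 h2
      rw [Fin.cycleIcc_of_gt h2, if_pos (by omega), beta]
  have hbl : beta N mu l = j + (N - 1 - l) := by
    have := Fin.le_def.1 hil
    rw [beta, hrow, if_neg (by omega), if_pos hl]
  refine ⟨hbeta, hbl, ?_⟩
  have hsub : rimHook lam (i, j) ⊆ lam.cells := Finset.filter_subset _ _
  have hmul : mu.colLen 0 ≤ N :=
    colLen_le_of_cells_subset (hmu ▸ Finset.sdiff_subset) hlam
  have hcard : mu.card + (rimHook lam (i, j)).card = lam.card := by
    rw [YoungDiagram.card, hmu, Finset.card_sdiff_add_card_eq_card hsub]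
  have h1 := card_eq_sum_beta_sub hlam
  have h2 := card_eq_sum_beta_sub hmul
  have h3 : ∑ m, ((beta N lam (Fin.cycleIcc i l m) : ℤ) - beta N mu m) =
      (rimHook lam (i, j)).card := by
    rw [Finset.sum_sub_distrib, Equiv.sum_comp (Fin.cycleIcc i l) fun m => (beta N lam m : ℤ)]
    rw [Finset.sum_sub_distrib] at h1 h2
    have : (mu.card : ℤ) + (rimHook lam (i, j)).card = lam.card := by exact_mod_cast hcard
    linarith
  rw [Finset.sum_eq_single l (fun m _ hm => by rw [hbeta m hm, sub_self]) (by simp),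
    Fin.cycleIcc_of_last hil, hbl] at h3
  omega

theorem exists_perm_of_stripsTo {r N : ℕ} {lam mu : YoungDiagram} (hlam : lam.colLen 0 ≤ N)
    (h : StripsTo r lam mu) :
    ∃ ρ : Equiv.Perm (Fin N), ∀ m, beta N lam (ρ m) ≡ beta N mu m [MOD r] := by
  obtain ⟨⟨i, j⟩, hx, hcard, hmu⟩ := h
  have h1 : i < lam.colLen j := YoungDiagram.mem_iff_lt_colLen.1 hx
  have h2 := lam.colLen_anti 0 j (Nat.zero_le j)
  have hi : i < N := by omega
  have hl : lam.colLen j - 1 < N := by omega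
  have : NeZero N := ⟨by omega⟩
  obtain ⟨h3, h4, h5⟩ := beta_of_cells_eq_sdiff_rimHook hlam (i := ⟨i, hi⟩)
    (l := ⟨lam.colLen j - 1, hl⟩) hx (by simp only; omega) hmu
  refine ⟨Fin.cycleIcc ⟨i, hi⟩ ⟨lam.colLen j - 1, hl⟩, fun m => ?_⟩
  by_cases hm : m = ⟨lam.colLen j - 1, hl⟩
  · subst hm
    rw [Fin.cycleIcc_of_last (Fin.le_def.2 (by simp only; omega)), h4, ← h5, hcard]
    exact Nat.add_modEq_left
  · rw [h3 m hm]

/-- An exponent `h ≥ r` such that `h - r` is not an exponent gives a rim hook of length `r`. -/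
theorem exists_stripsTo_of_beta {r N : ℕ} (hr : 0 < r) {lam : YoungDiagram}
    (hlam : lam.colLen 0 ≤ N) (i : Fin N) (hi : r ≤ beta N lam i)
    (hne : ∀ m, beta N lam m ≠ beta N lam i - r) : ∃ mu, StripsTo r lam mu := by
  have hanti := beta_strictAnti N lam
  obtain ⟨l, hl, hmax⟩ := (Finset.univ.filter fun m => beta N lam i - r < beta N lam m).exists_max_image
    id ⟨i, by simp; omega⟩
  simp only [Finset.mem_filter, Finset.mem_univ, true_and, id] at hl hmax
  have hil : i ≤ l := hmax i (by omega)
  have hlN := l.2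
  have hnext : N - 1 - (l : ℕ) ≤ beta N lam i - r ∧
      lam.rowLen (l + 1) + (N - 1 - l) ≤ beta N lam i - r := by
    by_cases h1 : (l : ℕ) + 1 < N
    · have h2 : ¬ beta N lam i - r < beta N lam ⟨l + 1, h1⟩ := fun h3 => by
        have := Fin.le_def.1 (hmax _ h3)
        simp at this
      have h3 := hne ⟨l + 1, h1⟩
      simp only [beta] at h2 h3 ⊢
      omega
    · have h2 := lt_colLen_iff_lt_rowLen lam (l + 1) 0
      omega
  set j := beta N lam i - r - (N - 1 - l) with hj
  have hlrow : j < lam.rowLen l := by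
    have : beta N lam l = lam.rowLen l + (N - 1 - l) := rfl
    omega
  have hcol : (l : ℕ) + 1 = lam.colLen j := by
    have h1 := lt_colLen_iff_lt_rowLen lam l j
    have h2 := lt_colLen_iff_lt_rowLen lam (l + 1) j
    omega
  have hx : ((i : ℕ), j) ∈ lam := by
    have := Fin.le_def.1 hil
    exact YoungDiagram.mem_iff_lt_colLen.2 (by omega)
  have h3 := (beta_of_cells_eq_sdiff_rimHook hlam hx hcol
    (mu := ⟨_, isLowerSet_sdiff_rimHook lam _⟩) rfl).2.2
  exact ⟨⟨_, isLowerSet_sdiff_rimHook lam (i, j)⟩, (i, j), hx, by omega, rfl⟩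

theorem eq_bot_of_not_stripsTo {r N : ℕ} (hr : 0 < r) {lam : YoungDiagram}
    (hlam : lam.colLen 0 ≤ N) (h : ∀ mu, ¬ StripsTo r lam mu) {π : Equiv.Perm (Fin N)}
    (hπ : ∀ i, beta N lam (π i) ≡ beta N ⊥ i [MOD r]) : lam = ⊥ := by
  have hinj := (beta_strictAnti N lam).injective
  have hinj0 := (beta_strictAnti N ⊥).injective
  have hclosed : ∀ v, (∃ m, beta N lam m = v + r) → ∃ m, beta N lam m = v := by
    rintro v ⟨m, hm⟩
    by_contra! h1
    obtain ⟨mu, hmu⟩ := exists_stripsTo_of_beta hr hlam m (by omega)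
      (by rwa [hm, Nat.add_sub_cancel])
    exact h mu hmu
  have hclosed' : ∀ v t, (∃ m, beta N lam m = v + r * t) → ∃ m, beta N lam m = v := by
    intro v t
    induction t with
    | zero => simp
    | succ t ih => exact fun hv => ih (hclosed _ (by rwa [add_assoc, ← mul_add_one]))
  have hrange : ∀ v < N, ∃ m, beta N lam m = v := by
    intro v hv
    by_contra hcon
    have hmaps : Set.MapsTo (fun i => beta N lam (π i))
        (Finset.univ.filter fun i => beta N ⊥ i ≤ v ∧ beta N ⊥ i ≡ v [MOD r] : Finset (Fin N))
        ((Finset.range v).filter fun u => u ≡ v [MOD r] : Finset ℕ) := by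
      intro i hi
      simp only [Finset.coe_filter, Finset.mem_univ, true_and, Set.mem_ofPred_eq,
        Finset.mem_range] at hi ⊢
      have h1 := (hπ i).trans hi.2
      refine ⟨?_, h1⟩
      by_contra! h2
      obtain ⟨t, ht⟩ := (Nat.modEq_iff_dvd' h2).1 h1.symm
      exact hcon (hclosed' v t ⟨π i, by omega⟩)
    have hc1 := Finset.card_le_card_of_injOn _ hmaps
      ((hinj.comp π.injective).injOn)
    have hc2 : ((Finset.range (v + 1)).filter fun u => u ≡ v [MOD r]).card ≤
        (Finset.univ.filter fun i => beta N ⊥ i ≤ v ∧ beta N ⊥ i ≡ v [MOD r]).card := by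
      rw [← Finset.card_image_of_injective _ hinj0]
      refine Finset.card_le_card fun u hu => ?_
      simp only [Finset.mem_filter, Finset.mem_range] at hu
      refine Finset.mem_image.2 ⟨⟨N - 1 - u, by omega⟩, ?_, ?_⟩
      · simp only [Finset.mem_filter, Finset.mem_univ, true_and, beta_bot]
        rw [show N - 1 - (N - 1 - u) = u by omega]
        exact ⟨by omega, hu.2⟩
      · simp only [beta_bot]
        omega
    rw [Finset.range_add_one, Finset.filter_insert, if_pos (Nat.ModEq.refl v),
      Finset.card_insert_of_notMem (by simp)] at hc2
    omega
  have himage : Finset.range N = Finset.univ.image (beta N lam) := by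
    refine Finset.eq_of_subset_of_card_le (fun v hv => ?_) ?_
    · obtain ⟨m, hm⟩ := hrange v (Finset.mem_range.1 hv)
      exact Finset.mem_image.2 ⟨m, Finset.mem_univ _, hm⟩
    · rw [Finset.card_image_of_injective _ hinj]
      simp
  rw [eq_bot_iff, ← YoungDiagram.cells_subset_iff]
  rintro ⟨a, b⟩ hab
  exfalso
  have h0 : (0, 0) ∈ lam := lam.up_left_mem (Nat.zero_le a) (Nat.zero_le b) hab
  have h1 := YoungDiagram.mem_iff_lt_colLen.1 h0
  have h2 := YoungDiagram.mem_iff_lt_rowLen.1 h0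
  have h3 : beta N lam ⟨0, by omega⟩ ∈ Finset.range N := by
    rw [himage]
    exact Finset.mem_image_of_mem _ (Finset.mem_univ _)
  rw [Finset.mem_range, beta] at h3
  simp only at h3
  omega

theorem not_stripsTo_bot (r : ℕ) (mu : YoungDiagram) : ¬ StripsTo r ⊥ mu := fun ⟨x, hx, _⟩ =>
  YoungDiagram.notMem_bot x hx

theorem StripsTo.cells_subset {r : ℕ} {lam mu : YoungDiagram} (h : StripsTo r lam mu) :
    mu.cells ⊆ lam.cells := by
  obtain ⟨x, -, -, hmu⟩ := h
  exact hmu ▸ Finset.sdiff_subset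

theorem StripsTo.card_lt {r : ℕ} (hr : 0 < r) {lam mu : YoungDiagram} (h : StripsTo r lam mu) :
    mu.card < lam.card := by
  obtain ⟨x, -, hcard, hmu⟩ := h
  have hsub : rimHook lam x ⊆ lam.cells := Finset.filter_subset _ _
  have := Finset.card_sdiff_add_card_eq_card hsub
  rw [YoungDiagram.card, YoungDiagram.card, hmu]
  omega

/-- The `r`-core is empty if and only if the exponents of `λ` agree modulo `r`, up to order, with
those of the empty diagram. -/
theorem isCoreOf_bot_iff {r N : ℕ} (hr : 0 < r) {lam : YoungDiagram} (hlam : lam.colLen 0 ≤ N) :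
    IsCoreOf r ⊥ lam ↔
      ∃ π : Equiv.Perm (Fin N), ∀ i, beta N lam (π i) ≡ beta N ⊥ i [MOD r] := by
  constructor
  · rintro ⟨h, -⟩
    revert hlam
    induction h using Relation.ReflTransGen.head_induction_on with
    | refl => exact fun _ => ⟨1, fun i => Nat.ModEq.refl _⟩
    | head h1 _ ih =>
      intro hlam
      obtain ⟨π, hπ⟩ := ih (colLen_le_of_cells_subset h1.cells_subset hlam)
      obtain ⟨ρ, hρ⟩ := exists_perm_of_stripsTo hlam h1
      exact ⟨ρ * π, fun i => (hρ (π i)).trans (hπ i)⟩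
  · rintro ⟨π, hπ⟩
    refine ⟨?_, not_stripsTo_bot r⟩
    induction hn : lam.card using Nat.strong_induction_on generalizing lam π with
    | _ n ih =>
      by_cases h : ∃ mu, StripsTo r lam mu
      · obtain ⟨mu, hmu⟩ := h
        obtain ⟨ρ, hρ⟩ := exists_perm_of_stripsTo hlam hmu
        refine Relation.ReflTransGen.head hmu (ih mu.card (hn ▸ hmu.card_lt hr)
          (colLen_le_of_cells_subset hmu.cells_subset hlam) (ρ⁻¹ * π) (fun i => ?_) rfl)
        refine Nat.ModEq.trans ?_ (hπ i)
        have := hρ ((ρ⁻¹ * π) i)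
        rw [Equiv.Perm.mul_apply, Equiv.Perm.coe_inv, Equiv.apply_symm_apply] at this
        simpa using this.symm
      · rw [eq_bot_of_not_stripsTo hr hlam (not_exists.1 h) hπ]

/-! ### Equidistribution of contents and the sign identity -/

section EmptyCore

variable {r N : ℕ} {lam : YoungDiagram} {π : Equiv.Perm (Fin N)} {d : Fin N → ℤ}

theorem card_eq_mul_sum (hlam : lam.colLen 0 ≤ N)
    (hd : ∀ i, (beta N lam (π i) : ℤ) = beta N ⊥ i + r * d i) :
    (lam.card : ℤ) = r * ∑ i, d i := by
  rw [card_eq_sum_beta_sub hlam, Finset.sum_sub_distrib,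
    ← Equiv.sum_comp π fun i => (beta N lam i : ℤ), ← Finset.sum_sub_distrib, Finset.mul_sum]
  exact Finset.sum_congr rfl fun i _ => by rw [hd]; ring

theorem sum_content_ediv_sub (hr : 0 < r) (hlam : lam.colLen 0 ≤ N)
    (hd : ∀ i, (beta N lam (π i) : ℤ) = beta N ⊥ i + r * d i) (b : ℤ) :
    ∑ x ∈ lam.cells, (((N : ℤ) + content x - b) / r - ((N : ℤ) + content x - 1 - b) / r) =
      ∑ i, d i := by
  have hr0 : (r : ℤ) ≠ 0 := by exact_mod_cast hr.ne'
  rw [sum_content_sub hlam fun n => (n - b) / r, Finset.sum_sub_distrib,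
    ← Equiv.sum_comp π fun i => ((beta N lam i : ℤ) - b) / r, ← Finset.sum_sub_distrib]
  refine Finset.sum_congr rfl fun i _ => ?_
  rw [hd, show (beta N ⊥ i : ℤ) + r * d i - b = beta N ⊥ i - b + r * d i by ring,
    Int.add_mul_ediv_left _ _ hr0]
  ring

theorem sum_add_content_ediv (hr : 0 < r) (hlam : lam.colLen 0 ≤ N)
    (hd : ∀ i, (beta N lam (π i) : ℤ) = beta N ⊥ i + r * d i) :
    ∑ x ∈ lam.cells, ((N : ℤ) + content x) / r =
      N * ∑ i, d i + ∑ x ∈ lam.cells, content x / (r : ℤ) := by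
  have h1 : ∀ M : ℕ, ∑ x ∈ lam.cells, ((N : ℤ) + content x) / r =
      M * ∑ i, d i + ∑ x ∈ lam.cells, ((N : ℤ) + content x - M) / r := by
    intro M
    induction M with
    | zero => simp
    | succ M ih =>
      rw [ih]
      have h2 := sum_content_ediv_sub hr hlam hd M
      rw [Finset.sum_sub_distrib] at h2
      have h3 : ∀ x, (N : ℤ) + content x - 1 - M = N + content x - (M + 1 : ℕ) := fun x => by
        push_cast
        ring
      simp only [h3] at h2
      push_cast at h2 ⊢
      linarith
  rw [h1 N]
  simp only [add_sub_cancel_left]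

theorem card_filter_content (hr : 0 < r) (hlam : lam.colLen 0 ≤ N)
    (hd : ∀ i, (beta N lam (π i) : ℤ) = beta N ⊥ i + r * d i) (a : ℕ) :
    ((lam.cells.filter fun x => (N : ℤ) + content x ≡ a [ZMOD r]).card : ℤ) = ∑ i, d i := by
  rw [← sum_content_ediv_sub hr hlam hd a, Finset.card_filter, Nat.cast_sum]
  refine Finset.sum_congr rfl fun x _ => ?_
  have hr0 : (0 : ℤ) < r := by exact_mod_cast hr
  set m := (N : ℤ) + content x with hm
  have hiff : m ≡ a [ZMOD r] ↔ (r : ℤ) ∣ m - a := Int.modEq_comm.trans Int.modEq_iff_dvd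
  simp only [hiff]
  rw [show m - 1 - a = (m - a) - 1 by ring]
  set y := m - a with hy
  split_ifs with h
  · obtain ⟨t, ht⟩ := h
    rw [ht, Int.mul_ediv_cancel_left _ hr0.ne', show (r : ℤ) * t - 1 = -1 + r * t by ring,
      Int.add_mul_ediv_left _ _ hr0.ne', Int.neg_one_ediv, Int.sign_eq_one_of_pos hr0]
    push_cast
    ring
  · have h2 := Int.emod_add_mul_ediv y r
    have h3 := Int.emod_lt_of_pos y hr0
    have h4 := Int.emod_nonneg y hr0.ne'
    have h5 : y % r ≠ 0 := fun h6 => h (Int.dvd_of_emod_eq_zero h6)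
    rw [((Int.ediv_emod_unique (a := y - 1) (q := y / r) (r := y % r - 1) hr0).2
      ⟨by omega, by omega, by omega⟩).1]
    simp

theorem prod_stepFactor_mul (hr : 0 < r) (hlam : lam.colLen 0 ≤ N)
    (hd : ∀ i, (beta N lam (π i) : ℤ) = beta N ⊥ i + r * d i) (a : ℕ) :
    (∏ i, ∏ n ∈ Finset.range (beta N lam i), stepFactor r a (n + 1)) * (r : ℝ) ^ (lam.card / r) =
      (∏ x ∈ lam.cells, (bracket r a (N + content x) : ℝ)) *
        ∏ i, ∏ n ∈ Finset.range (beta N ⊥ i), stepFactor r a (n + 1) := by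
  have hr0 : (r : ℝ) ≠ 0 := by exact_mod_cast hr.ne'
  have hcard : lam.card / r = (lam.cells.filter fun x =>
      (N : ℤ) + content x ≡ a [ZMOD r]).card := by
    have h1 := card_eq_mul_sum hlam hd
    rw [← card_filter_content hr hlam hd a] at h1
    rw [show lam.card = r * _ from by exact_mod_cast h1, Nat.mul_div_cancel_left _ hr]
  have h1 := prod_content_mul hlam fun n : ℤ => stepFactor r a n.toNat
  simp only [show ∀ n : ℕ, ((n : ℤ) + 1).toNat = n + 1 from fun n => by omega] at h1
  rw [← h1, hcard, ← Finset.prod_const, Finset.prod_filter, mul_right_comm,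
    ← Finset.prod_mul_distrib]
  congr 1
  refine Finset.prod_congr rfl fun x hx => ?_
  have hpos := add_content_pos hlam hx
  obtain ⟨n, hn⟩ := Int.eq_ofNat_of_zero_le hpos.le
  rw [hn, Int.toNat_natCast, stepFactor, bracket]
  simp only [Int.natCast_modEq_iff]
  split_ifs
  · rw [div_mul_cancel₀ _ hr0, Int.cast_natCast]
  · simp

theorem prod_bracket_mul (hr : 0 < r) (hlam : lam.colLen 0 ≤ N)
    (hd : ∀ i, (beta N lam (π i) : ℤ) = beta N ⊥ i + r * d i) :
    (∏ x ∈ lam.cells, bracket r 0 (hookLength lam x)) *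
        (Equiv.Perm.sign π * ∏ j, ∏ i ∈ Finset.Iio j,
          bracket r 0 ((beta N lam (π i) : ℤ) - beta N lam (π j))) =
      (-1) ^ (lam.card / r) * (∏ x ∈ lam.cells,
          (Int.negOnePow (content x / (r : ℤ) + hookLength lam x / (r : ℤ)) : ℤ)) *
        (∏ x ∈ lam.cells, bracket r 0 (N + content x)) *
        ∏ j, ∏ i ∈ Finset.Iio j, bracket r 0 ((beta N ⊥ i : ℤ) - beta N ⊥ j) := by
  have hr0 : (r : ℤ) ≠ 0 := by exact_mod_cast hr.ne'
  set D := ∑ i, d i with hD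
  have hsq : ∀ n : ℤ, (n.negOnePow : ℤ) * n.negOnePow = 1 := fun n => by
    rw [← Units.val_mul, Int.units_mul_self, Units.val_one]
  have hne : ∀ n : ℤ, (n.negOnePow : ℤ) ≠ 0 := fun n => Units.ne_zero _
  set S : ℤ := ∑ j, ∑ i ∈ Finset.Iio j, ((beta N ⊥ i : ℤ) - beta N ⊥ j) / r with hS
  set C : ℤ := ∑ x ∈ lam.cells, content x / (r : ℤ) with hC
  set K : ℤ := ∑ x ∈ lam.cells, hookLength lam x / (r : ℤ) with hK
  have hpp : ∀ g : Fin N → Fin N → ℤ, ∏ j, ∏ i ∈ Finset.Iio j, ((g i j).negOnePow : ℤ) =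
      ((∑ j, ∑ i ∈ Finset.Iio j, g i j).negOnePow : ℤ) := fun g => by
    simp only [prod_negOnePow]
  have h1 := prod_hookLength_mul_eq_prod_content_mul hlam (signedBracket r)
  have h2 := Equiv.Perm.prod_Iio_comp_eq_sign_mul_prod π
    (f := fun i j => signedBracket r ((beta N lam i : ℤ) - beta N lam j))
    (fun i j => by rw [← signedBracket_neg hr, neg_sub])
  have h3 : ∏ j, ∏ i ∈ Finset.Iio j,
      signedBracket r ((beta N lam (π i) : ℤ) - beta N lam (π j)) =
      (Int.negOnePow (S + ((N : ℤ) - 1) * D) : ℤ) * ∏ j, ∏ i ∈ Finset.Iio j,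
        bracket r 0 ((beta N lam (π i) : ℤ) - beta N lam (π j)) := by
    rw [hS, hD, ← sum_sum_Iio_add, ← Finset.sum_add_distrib]
    simp only [← Finset.sum_add_distrib]
    rw [← hpp fun i j => ((beta N ⊥ i : ℤ) - beta N ⊥ j) / r + (d i + d j)]
    simp only [← Finset.prod_mul_distrib]
    refine Finset.prod_congr rfl fun j _ => Finset.prod_congr rfl fun i _ => ?_
    rw [signedBracket]
    congr 2
    rw [hd, hd, show (beta N ⊥ i : ℤ) + r * d i - (beta N ⊥ j + r * d j) =
      beta N ⊥ i - beta N ⊥ j + r * (d i - d j) by ring, Int.add_mul_ediv_left _ _ hr0,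
      Int.negOnePow_add, Int.negOnePow_add, Int.negOnePow_sub, Int.negOnePow_add]
  have h4 : ∏ j, ∏ i ∈ Finset.Iio j, signedBracket r ((beta N ⊥ i : ℤ) - beta N ⊥ j) =
      (S.negOnePow : ℤ) *
        ∏ j, ∏ i ∈ Finset.Iio j, bracket r 0 ((beta N ⊥ i : ℤ) - beta N ⊥ j) := by
    simp only [signedBracket, Finset.prod_mul_distrib]
    rw [hpp]
  have h5 : ∏ x ∈ lam.cells, signedBracket r (hookLength lam x) =
      (K.negOnePow : ℤ) * ∏ x ∈ lam.cells, bracket r 0 (hookLength lam x) := by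
    simp only [signedBracket, Finset.prod_mul_distrib]
    rw [prod_negOnePow]
  have h6 : ∏ x ∈ lam.cells, signedBracket r (N + content x) =
      (Int.negOnePow (N * D + C) : ℤ) * ∏ x ∈ lam.cells, bracket r 0 (N + content x) := by
    simp only [signedBracket, Finset.prod_mul_distrib]
    rw [prod_negOnePow, sum_add_content_ediv hr hlam hd]
  have h7 : ((-1 : ℤ)) ^ (lam.card / r) = (D.negOnePow : ℤ) := by
    have h8 : ((lam.card / r : ℕ) : ℤ) = D := by
      rw [Int.natCast_ediv, card_eq_mul_sum hlam hd, Int.mul_ediv_cancel_left _ hr0]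
    rw [← h8, Int.negOnePow_def, zpow_natCast]
    simp
  have h9 : (∏ x ∈ lam.cells,
      (Int.negOnePow (content x / (r : ℤ) + hookLength lam x / (r : ℤ)) : ℤ)) =
      (C.negOnePow : ℤ) * K.negOnePow := by
    rw [prod_negOnePow, Finset.sum_add_distrib, Int.negOnePow_add, Units.val_mul]
  rw [h5, h6, h4] at h1
  rw [h3] at h2
  simp only [Int.cast_id] at h2
  set Q := ∏ j, ∏ i ∈ Finset.Iio j, signedBracket r ((beta N lam i : ℤ) - beta N lam j)
  set P := ∏ j, ∏ i ∈ Finset.Iio j, bracket r 0 ((beta N lam (π i) : ℤ) - beta N lam (π j))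
  set B := ∏ x ∈ lam.cells, bracket r 0 (hookLength lam x)
  set A := ∏ x ∈ lam.cells, bracket r 0 ((N : ℤ) + content x)
  set T := ∏ j, ∏ i ∈ Finset.Iio j, bracket r 0 ((beta N ⊥ i : ℤ) - beta N ⊥ j)
  rw [h7, h9]
  have hs : ((Equiv.Perm.sign π : ℤˣ) : ℤ) * (Equiv.Perm.sign π : ℤˣ) = 1 := by
    rw [← Units.val_mul, Int.units_mul_self, Units.val_one]
  have h10 : (Int.negOnePow (S + ((N : ℤ) - 1) * D) : ℤ) =
      S.negOnePow * (Int.negOnePow (N * D) : ℤ) * D.negOnePow := by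
    rw [sub_mul, one_mul, Int.negOnePow_add, Int.negOnePow_sub, Units.val_mul, Units.val_mul,
      mul_assoc]
  rw [h10] at h2
  rw [Int.negOnePow_add, Units.val_mul] at h1
  generalize ((Equiv.Perm.sign π : ℤˣ) : ℤ) = s at *
  have e1 := hsq S
  have e2 := hsq (N * D)
  have e3 := hsq D
  have e4 := hsq K
  generalize (S.negOnePow : ℤ) = σ at *
  generalize (Int.negOnePow (N * D) : ℤ) = ν at *
  generalize (D.negOnePow : ℤ) = δ at *
  generalize (K.negOnePow : ℤ) = κ at *
  generalize (C.negOnePow : ℤ) = γ at *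
  have e5 : s * P = σ * ν * δ * Q := by
    calc s * P = s * ((σ * σ) * (ν * ν) * (δ * δ)) * P := by rw [e1, e2, e3]; ring
      _ = s * (σ * ν * δ) * (σ * ν * δ * P) := by ring
      _ = (s * s) * (σ * ν * δ) * Q := by rw [h2]; ring
      _ = _ := by rw [hs]; ring
  calc B * (s * P) = (κ * κ) * B * (σ * ν * δ * Q) := by rw [e4, e5]; ring
    _ = κ * σ * ν * δ * (κ * B * Q) := by ring
    _ = (σ * σ) * (ν * ν) * (δ * (γ * κ) * A * T) := by rw [h1]; ring
    _ = _ := by rw [e1, e2, one_mul, one_mul]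

end EmptyCore

/-! ### The average of a Schur polynomial -/

theorem moment_ne_zero {r a n : ℕ} (h : moment r a n ≠ 0) : n + 1 ≡ a [MOD r] := by
  by_contra h1
  exact h (if_neg h1)

theorem exists_perm_of_det_moment_ne_zero {r a N : ℕ} {lam : YoungDiagram}
    (h : (Matrix.of fun i j : Fin N => moment r a (beta N lam i + beta N ⊥ j)).det ≠ 0) :
    ∃ σ : Equiv.Perm (Fin N), ∀ i, beta N lam i + beta N ⊥ (σ i) + 1 ≡ a [MOD r] := by
  rw [← Matrix.det_transpose, Matrix.det_apply] at h
  obtain ⟨σ, -, hσ⟩ := Finset.exists_ne_zero_of_sum_ne_zero h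
  refine ⟨σ, fun i => moment_ne_zero fun h0 => hσ ?_⟩
  rw [Finset.prod_eq_zero (Finset.mem_univ i), smul_zero]
  exact h0

theorem Z_eq_det {r a N : ℕ} (hr : 0 < r) :
    Z r a N = (Matrix.of fun i j : Fin N => moment r a (beta N ⊥ i + beta N ⊥ j)).det := by
  rw [Z, ← schur_bot N, ZInsert_schur hr]

theorem average_schur_eq_zero {r a N : ℕ} (hr : 0 < r) (hZ : Z r a N ≠ 0) {lam : YoungDiagram}
    (hlam : lam.colLen 0 ≤ N) (hcore : ¬ IsCoreOf r ⊥ lam) : average r a N (schur N lam) = 0 := by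
  rw [average, div_eq_zero_iff]
  left
  by_contra h
  rw [ZInsert_schur hr] at h
  rw [Z_eq_det hr] at hZ
  obtain ⟨σ, hσ⟩ := exists_perm_of_det_moment_ne_zero h
  obtain ⟨τ, hτ⟩ := exists_perm_of_det_moment_ne_zero hZ
  refine hcore ((isCoreOf_bot_iff hr hlam).2 ⟨σ⁻¹ * τ, fun i => ?_⟩)
  have h1 := hσ (σ.symm (τ i))
  rw [Equiv.apply_symm_apply] at h1
  have h2 := h1.trans (hτ i).symm
  rw [add_assoc, add_assoc] at h2
  exact Nat.ModEq.add_right_cancel' _ h2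

theorem bracket_sub_eq {r : ℕ} (x y : ℕ) : ((bracket r 0 ((x : ℤ) - y) : ℤ) : ℂ) =
    if x % r = y % r then (x : ℂ) - y else 1 := by
  have h : (x : ℤ) - y ≡ (0 : ℕ) [ZMOD r] ↔ x % r = y % r := by
    rw [Nat.cast_zero, Int.modEq_zero_iff_dvd, ← Int.modEq_iff_dvd, Int.natCast_modEq_iff]
    exact eq_comm
  simp only [bracket, h]
  split_ifs <;> simp

theorem exists_det_moment_beta_eq {r a N : ℕ} (hr : 0 < r) (ha : a < r) (hZ : Z r a N ≠ 0) :
    ∃ C : ℂ, ∀ (lam : YoungDiagram) (π : Equiv.Perm (Fin N)),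
      (∀ i, beta N lam (π i) ≡ beta N ⊥ i [MOD r]) →
      ZInsert r a N (schur N lam) =
        C * ((Equiv.Perm.sign π : ℤ) : ℂ) *
          ((∏ i, ∏ n ∈ Finset.range (beta N lam i), stepFactor r a (n + 1) : ℝ) : ℂ) *
          ((∏ j, ∏ i ∈ Finset.Iio j,
            bracket r 0 ((beta N lam (π i) : ℤ) - beta N lam (π j)) : ℤ) : ℂ) := by
  rw [Z_eq_det hr] at hZ
  obtain ⟨σ, hσ⟩ := exists_perm_of_det_moment_ne_zero hZ
  obtain ⟨C, hC⟩ := exists_det_moment_eq hr ha σ hσ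
  refine ⟨((Equiv.Perm.sign σ : ℤ) : ℂ) * C, fun lam π hπ => ?_⟩
  have hs : ∀ τ : Equiv.Perm (Fin N),
      ((Equiv.Perm.sign τ : ℤ) : ℂ) * ((Equiv.Perm.sign τ : ℤ) : ℂ) = 1 := fun τ => by
    rw [← Int.cast_mul, ← Units.val_mul, Int.units_mul_self, Units.val_one, Int.cast_one]
  set M : Matrix (Fin N) (Fin N) ℂ :=
    Matrix.of fun i j : Fin N => moment r a (beta N lam i + beta N ⊥ j) with hM
  have h1 : ((M.submatrix π id).submatrix id σ).det =
      C * ((∏ i, ∏ n ∈ Finset.range (beta N lam (π i)), stepFactor r a (n + 1) : ℝ) : ℂ) *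
          ∏ j, ∏ i ∈ Finset.Iio j, if beta N ⊥ i % r = beta N ⊥ j % r then
            (beta N lam (π i) : ℂ) - beta N lam (π j) else 1 :=
    hC (fun i => beta N lam (π i)) hπ
  rw [Matrix.det_permute', Matrix.det_permute,
    Equiv.prod_comp π fun i => ∏ n ∈ Finset.range (beta N lam i), stepFactor r a (n + 1)] at h1
  have h2 : ((∏ j, ∏ i ∈ Finset.Iio j,
      bracket r 0 ((beta N lam (π i) : ℤ) - beta N lam (π j)) : ℤ) : ℂ) =
      ∏ j, ∏ i ∈ Finset.Iio j, if beta N ⊥ i % r = beta N ⊥ j % r then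
        (beta N lam (π i) : ℂ) - beta N lam (π j) else 1 := by
    simp only [Int.cast_prod, bracket_sub_eq]
    refine Finset.prod_congr rfl fun j _ => Finset.prod_congr rfl fun i _ => ?_
    rw [show beta N lam (π i) % r = beta N ⊥ i % r from hπ i,
      show beta N lam (π j) % r = beta N ⊥ j % r from hπ j]
  rw [ZInsert_schur hr, h2]
  calc M.det = (((Equiv.Perm.sign σ : ℤ) : ℂ) * ((Equiv.Perm.sign σ : ℤ) : ℂ)) *
        (((Equiv.Perm.sign π : ℤ) : ℂ) * ((Equiv.Perm.sign π : ℤ) : ℂ)) * M.det := by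
        rw [hs, hs, one_mul, one_mul]
    _ = ((Equiv.Perm.sign σ : ℤ) : ℂ) * ((Equiv.Perm.sign π : ℤ) : ℂ) *
        (((Equiv.Perm.sign σ : ℤ) : ℂ) * (((Equiv.Perm.sign π : ℤ) : ℂ) * M.det)) := by ring
    _ = _ := by
      rw [h1]
      ring

theorem average_schur_of_isCoreOf {r a N : ℕ} (hr : 0 < r) (ha : a < r) (hZ : Z r a N ≠ 0)
    {lam : YoungDiagram} (hlam : lam.colLen 0 ≤ N) (hcore : IsCoreOf r ⊥ lam) :
    average r a N (schur N lam) =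
      (signature r lam : ℂ) / (((r : ℝ) ^ ((lam.card : ℝ) / (r : ℝ)) : ℝ) : ℂ) *
        ∏ x ∈ lam.cells, ((bracket r 0 ((N : ℤ) + content x) : ℂ) *
          (bracket r a ((N : ℤ) + content x) : ℂ)) / (bracket r 0 (hookLength lam x) : ℂ) := by
  obtain ⟨π, hπ⟩ := (isCoreOf_bot_iff hr hlam).1 hcore
  choose d hd' using fun i => (Nat.modEq_iff_dvd.1 (hπ i).symm)
  have hd : ∀ i, (beta N lam (π i) : ℤ) = beta N ⊥ i + r * d i := fun i => by
    rw [← hd']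
    ring
  obtain ⟨C, hC⟩ := exists_det_moment_beta_eq hr ha hZ
  have hbot := hC ⊥ 1 fun i => Nat.ModEq.refl _
  rw [schur_bot] at hbot
  simp only [Equiv.Perm.sign_one, Units.val_one, Int.cast_one, mul_one,
    Equiv.Perm.one_apply] at hbot
  have hstep := prod_stepFactor_mul hr hlam hd a
  have hbr := prod_bracket_mul hr hlam hd
  have hr0 : (r : ℝ) ≠ 0 := by exact_mod_cast hr.ne'
  have hcard : (lam.card : ℝ) / (r : ℝ) = ((lam.card / r : ℕ) : ℝ) := by
    have h1 : r ∣ lam.card := by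
      have := card_eq_mul_sum hlam hd
      exact Int.natCast_dvd_natCast.1 ⟨_, this⟩
    rw [Nat.cast_div h1 hr0]
  have hB0 : (∏ x ∈ lam.cells, bracket r 0 (hookLength lam x)) ≠ 0 :=
    Finset.prod_ne_zero_iff.2 fun x hx => bracket_ne_zero (hookLength_pos hx).ne'
  have hZ' := hZ
  rw [Z, hbot] at hZ'
  have hC0 : C ≠ 0 := left_ne_zero_of_mul (left_ne_zero_of_mul hZ')
  have hF0 := right_ne_zero_of_mul (left_ne_zero_of_mul hZ')
  have hT0 := right_ne_zero_of_mul hZ'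
  rw [average, Z, hbot, hC lam π hπ, signature, if_pos hcore, hcard, Real.rpow_natCast]
  rw [Finset.prod_div_distrib, Finset.prod_mul_distrib]
  replace hstep := congrArg (fun x : ℝ => (x : ℂ)) hstep
  replace hbr := congrArg (fun x : ℤ => (x : ℂ)) hbr
  simp only [Complex.ofReal_mul, Int.cast_mul] at hstep hbr
  rw [show ((∏ x ∈ lam.cells, (bracket r a (N + content x) : ℝ) : ℝ) : ℂ) =
    ∏ x ∈ lam.cells, ((bracket r a (N + content x) : ℤ) : ℂ) by push_cast; rfl] at hstep
  simp only [← Int.cast_prod] at hstep hbr ⊢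
  rw [Int.cast_mul]
  have hB0' : ((∏ x ∈ lam.cells, bracket r 0 (hookLength lam x) : ℤ) : ℂ) ≠ 0 := by
    exact_mod_cast hB0
  have hR0 : (((r : ℝ) ^ (lam.card / r) : ℝ) : ℂ) ≠ 0 := by exact_mod_cast pow_ne_zero _ hr0
  generalize ((∏ x ∈ lam.cells, bracket r 0 (hookLength lam x) : ℤ) : ℂ) = B at *
  generalize (((r : ℝ) ^ (lam.card / r) : ℝ) : ℂ) = R at *
  rw [div_mul_div_comm, div_eq_div_iff (mul_ne_zero (mul_ne_zero hC0 hF0) hT0)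
    (mul_ne_zero hR0 hB0')]
  linear_combination C * B * ((Equiv.Perm.sign π : ℤ) : ℂ) * ((∏ j, ∏ i ∈ Finset.Iio j,
            bracket r 0 ((beta N lam (π i) : ℤ) - beta N lam (π j)) : ℤ) : ℂ) * hstep +
     C * ((∏ x ∈ lam.cells, bracket r a (N + content x) : ℤ) : ℂ) *
     ((∏ i, ∏ n ∈ Finset.range (beta N ⊥ i), stepFactor r a (n + 1) : ℝ) : ℂ) * hbr

end MonomialModel

theorem mainTheorem2 (r a N : ℕ) (hr : 0 < r) (ha : a < r) (hZ : MonomialModel.Z r a N ≠ 0)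
    (lam : YoungDiagram) (hlam : lam.colLen 0 ≤ N) :
    MonomialModel.average r a N (MonomialModel.schur N lam) =
      (MonomialModel.signature r lam : ℂ) / (((r : ℝ) ^ ((lam.card : ℝ) / (r : ℝ)) : ℝ) : ℂ) *
        ∏ x ∈ lam.cells,
          ((MonomialModel.bracket r 0 ((N : ℤ) + MonomialModel.content x) : ℂ) *
              (MonomialModel.bracket r a ((N : ℤ) + MonomialModel.content x) : ℂ)) /
            (MonomialModel.bracket r 0 (MonomialModel.hookLength lam x) : ℂ) := by
  by_cases hcore : MonomialModel.IsCoreOf r ⊥ lam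
  · exact MonomialModel.average_schur_of_isCoreOf hr ha hZ hlam hcore
  · rw [MonomialModel.average_schur_eq_zero hr hZ hlam hcore, MonomialModel.signature,
      if_neg hcore]
    simp
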